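/- Let $d\ge 1$, $N=\{1,\dots,d\}$, and $\varphi(\boldsymbol x)=\{l\in N: x_l\neq 0\}$ for $\boldsymbol x\in\mathbb Z_+^d$. For each $A\subset N$ let $S^A$ be a finite nonempty set. A $d$-dimensional skip-free Markov modulated reflecting random walk (MMRRW) is a time-homogeneous Markov chain $\{\boldsymbol Y_n\}=\{(\boldsymbol X_n,J_n)\}$ on $\mathcal S=\bigcup_{\boldsymbol x\in\mathbb Z_+^d}\{\boldsymbol x\}\times S^{\varphi(\boldsymbol x)}$ whose transition probability from $(\boldsymbol x,i)$ to $(\boldsymbol x+\boldsymbol z,j)$ is of the form $p_{\boldsymbol z}^{\varphi(\boldsymbol x)\,\varphi(\boldsymbol x+\boldsymbol z)}(i,j)$ for $\boldsymbol z\in\{-1,0,1\}^d$ with $\boldsymbol x+\boldsymbol z\in\mathbb Z_+^d$; no other transitions occur. Write $\boldsymbol\alpha(\boldsymbol y)=E(\boldsymbol X_{n+1}-\boldsymbol X_n\mid \boldsymbol Y_n=\boldsymbol y)$. For nonempty $A\subset N$, write $(\boldsymbol x^{N\setminus A},\boldsymbol x^{A})$ for the vector with the indicated coordinates off and on $A$,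 and let $\boldsymbol 2^A$ be the vector of $2$'s indexed by $A$. The induced chain $\mathcal L^A$ is the Markov chain on $\mathcal S^A=\bigcup_{\boldsymbol x^{N\setminus A}\in\mathbb Z_+^{N\setminus A}}\{\boldsymbol x^{N\setminus A}\}\times S^{\varphi(\boldsymbol x^{N\setminus A},\boldsymbol 2^A)}$ whose transition probability from $(\boldsymbol x^{N\setminus A},i)$ to $(\boldsymbol x^{N\setminus A}+\boldsymbol z^{N\setminus A},j)$, $\boldsymbol z^{N\setminus A}\in\{-1,0,1\}^{N\setminus A}$, is $$\sum_{\boldsymbol z^A\in\{-1,0,1\}^{A}} p_{(\boldsymbol z^{N\setminus A},\boldsymbol z^A)}^{\varphi(\boldsymbol x^{N\setminus A},\boldsymbol 2^A)\,\varphi(\boldsymbol x^{N\setminus A}+\boldsymbol z^{N\setminus A},\boldsymbol 2^A)}(i,j).$$ If $\mathcal L^A$ is positive recurrent with stationary distribution $\boldsymbol\pi^A$, define $\boldsymbol a(A)\in\mathbb R^d$ by $$a_l(A)=\sum_{(\boldsymbol x^{N\setminus A},i)\in\mathcal S^A}\alpha_l\big((\boldsymbol x^{N\setminus A},\boldsymbol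 2^A),i\big)\,\pi^A(\boldsymbol x^{N\setminus A},i),\qquad l\in N.$$ **Theorem.** Assume that $\{\boldsymbol Y_n\}$ is irreducible and that $\mathcal L^A$ is irreducible for every nonempty $A\subset N$. Suppose that for some nonempty $A\subset N$ there is a vector $\boldsymbol w\in\mathbb R^d$ such that $w_l>0$ for all $l\in A$, $w_l<0$ for all $l\in N\setminus A$, and $\langle \boldsymbol a(B),\boldsymbol w\rangle>0$ for every $B\subset N$ with $B\cap A\neq\emptyset$ for which $\mathcal L^B$ is positive recurrent. Then $\{\boldsymbol Y_n\}$ is transient. -/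

import Mathlib

open scoped ENNReal NNReal

/-! ### Discrete-time Markov chains on a discrete state space -/

namespace MarkovChain

variable {S : Type*}

/-- The `n`-step transition law of the time-homogeneous Markov chain whose one-step transition
law out of the state `x` is `P x`. -/
noncomputable def nStep (P : S → PMF S) : ℕ → S → PMF S
  | 0, x => PMF.pure x
  | n + 1, x => (P x).bind (nStep P n)

/-- Every state can be reached from every state with positive probability. -/
def IsIrreducible (P : S → PMF S) : Prop :=
  ∀ x y : S, ∃ n : ℕ, 0 < nStep P n x y

open Classical in
/-- `firstPassage P y n x` is the probability that the chain started at `x` visits `y`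
at time `n + 1` and at none of the times `1, …, n`. -/
noncomputable def firstPassage (P : S → PMF S) (y : S) : ℕ → S → ℝ≥0∞
  | 0, x => P x y
  | n + 1, x => ∑' z, if z = y then 0 else P x z * firstPassage P y n z

/-- The probability that the chain started at `y` ever returns to `y`. -/
noncomputable def returnProb (P : S → PMF S) (y : S) : ℝ≥0∞ :=
  ∑' n : ℕ, firstPassage P y n y

/-- The expectation of the time of first return to `y`, on the event that it is finite. -/
noncomputable def meanReturnTime (P : S → PMF S) (y : S) : ℝ≥0∞ :=
  ∑' n : ℕ, ((n : ℝ≥0∞) + 1) * firstPassage P y n y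

/-- From every state, the chain fails to return to it with positive probability. -/
def IsTransient (P : S → PMF S) : Prop :=
  ∀ y : S, returnProb P y < 1

/-- From every state, the chain returns to it almost surely and in finite mean time. -/
def IsPositiveRecurrent (P : S → PMF S) : Prop :=
  ∀ y : S, returnProb P y = 1 ∧ meanReturnTime P y < ∞

/-- `π` is a stationary distribution: `π P = π`. -/
def IsStationary (P : S → PMF S) (π : PMF S) : Prop :=
  π.bind P = π

open Classical in
/-- The stationary distribution of the chain, as a function on the states
(unique for an irreducible positive recurrent chain; zero if there is none). -/
noncomputable def stationaryDist (P : S → PMF S) : S → ℝ≥0∞ :=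
  if h : ∃ π : PMF S, IsStationary P π then ⇑h.choose else 0

end MarkovChain

/-! ### Markov modulated reflecting random walks -/

/-- The set `φ(x)` of the nonzero coordinates of `x`. -/
def face {d : ℕ} (x : Fin d → ℕ) : Finset (Fin d) :=
  Finset.univ.filter fun l => x l ≠ 0

/-- The points of the nonnegative orthant that differ from `x` by at most one in each
coordinate, that is, the points `x + z ≥ 0` with `z ∈ {-1, 0, 1}^ι`
(the truncated subtraction is intended). -/
def neighbours {ι : Type*} [Fintype ι] [DecidableEq ι] (x : ι → ℕ) : Finset (ι → ℕ) :=
  Fintype.piFinset fun l => Finset.Icc (x l - 1) (x l + 1)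

/-- The vector `x' - x` with integer coordinates. -/
def incr {ι : Type*} (x x' : ι → ℕ) : ι → ℤ := fun l => (x' l : ℤ) - (x l : ℤ)

/-- The vector `(u, v)` whose coordinates outside `A` are those of `u` and whose coordinates
in `A` are those of `v`. -/
def glue {d : ℕ} {β : Type*} (A : Finset (Fin d)) (u : {l // l ∉ A} → β) (v : {l // l ∈ A} → β) :
    Fin d → β :=
  fun l => if h : l ∈ A then v ⟨l, h⟩ else u ⟨l, h⟩

/-- The set `{-1, 0, 1}^ι`. -/
def unitSteps (ι : Type*) [Fintype ι] [DecidableEq ι] : Finset (ι → ℤ) :=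
  Fintype.piFinset fun _ => {-1, 0, 1}

/-- The data of a `d`-dimensional skip-free Markov modulated reflecting random walk:
for each face `A` the finite nonempty set `Fin (s A)` of background states, and the
transition probabilities `p z A B i j` of jumping by `z` from a point of the face `A` with
background state `i` to a point of the face `B` with background state `j`. -/
structure MMRRW (d : ℕ) where
  s : Finset (Fin d) → ℕ
  s_pos : ∀ A, 0 < s A
  p : (Fin d → ℤ) → (A B : Finset (Fin d)) → Fin (s A) → Fin (s B) → ℝ≥0
  sum_p : ∀ (x : Fin d → ℕ) (i : Fin (s (face x))),
    ∑ x' ∈ neighbours x, ∑ j : Fin (s (face x')), p (incr x x') (face x) (face x') i j = 1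

namespace MMRRW

variable {d : ℕ} (L : MMRRW d)

/-- The state space: pairs of a point `x` of the orthant and a background state of its face. -/
abbrev State : Type := Σ x : Fin d → ℕ, Fin (L.s (face x))

/-- The transition law of the chain. -/
noncomputable def chain (y : L.State) : PMF L.State :=
  PMF.ofFinset
    (fun y' => if y'.1 ∈ neighbours y.1 then
      (L.p (incr y.1 y'.1) (face y.1) (face y'.1) y.2 y'.2 : ℝ≥0∞) else 0)
    ((neighbours y.1).sigma fun _ => Finset.univ)
    (by
      rw [Finset.sum_sigma]
      have h := L.sum_p y.1 y.2
      have h' := congrArg (fun r : ℝ≥0 => (r : ℝ≥0∞)) h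
      simp only [ENNReal.ofNNReal_finsetSum, ENNReal.coe_one] at h'
      rw [← h']
      refine Finset.sum_congr rfl fun x' hx' => Finset.sum_congr rfl fun j _ => ?_
      simp [hx'])
    (by
      rintro ⟨x', j⟩ h
      have : x' ∉ neighbours y.1 := fun hx => h (by simp [hx])
      simp [this])

/-- The conditional mean increment `α(y)` of the front process out of the state `y`. -/
noncomputable def drift (y : L.State) (l : Fin d) : ℝ :=
  ∑' y' : L.State, (L.chain y y').toReal * ((y'.1 l : ℝ) - (y.1 l : ℝ))

/-- The state space of the induced chain of `A`: pairs of a point `x` of the orthant of the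
coordinates outside `A` and a background state of the face of `(x, 2)`. -/
abbrev InducedState (A : Finset (Fin d)) : Type :=
  Σ x : {l // l ∉ A} → ℕ, Fin (L.s (face (glue A x fun _ => 2)))

/-- The state `((x, 2), i)` of the walk, for a state `(x, i)` of the induced chain of `A`. -/
def lift (A : Finset (Fin d)) (y : L.InducedState A) : L.State :=
  ⟨glue A y.1 fun _ => 2, y.2⟩

theorem sum_induced (A : Finset (Fin d)) (x : {l // l ∉ A} → ℕ)
    (i : Fin (L.s (face (glue A x fun _ => 2)))) :
    ∑ x' ∈ neighbours x, ∑ j : Fin (L.s (face (glue A x' fun _ => 2))),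
      ∑ z ∈ unitSteps {l // l ∈ A},
        L.p (glue A (incr x x') z) (face (glue A x fun _ => 2))
          (face (glue A x' fun _ => 2)) i j = 1 := by
  rw [← L.sum_p _ i]
  simp_rw [Finset.sum_comm (s := Finset.univ) (t := unitSteps {l // l ∈ A})]
  rw [← Finset.sum_product']
  refine Finset.sum_bij'
    (fun q _ => glue A q.1 fun l => (2 + q.2 l).toNat)
    (fun X _ => (fun l => X l, fun l => (X l : ℤ) - 2)) ?_ ?_ ?_ ?_ ?_
  · rintro ⟨x', z⟩ h
    simp only [Finset.mem_product, neighbours, unitSteps, Fintype.mem_piFinset,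
      Finset.mem_Icc, Finset.mem_insert, Finset.mem_singleton] at h ⊢
    intro l
    by_cases hl : l ∈ A
    · have := h.2 ⟨l, hl⟩
      simp only [glue, hl, dif_pos]
      omega
    · simpa only [glue, hl, dif_neg, not_false_iff] using h.1 ⟨l, hl⟩
  · intro X h
    simp only [Finset.mem_product, neighbours, unitSteps, Fintype.mem_piFinset,
      Finset.mem_Icc, Finset.mem_insert, Finset.mem_singleton] at h ⊢
    refine ⟨fun l => ?_, fun l => ?_⟩
    · simpa only [glue, l.2, dif_neg, not_false_iff] using h l
    · have := h l
      simp only [glue, l.2, dif_pos] at this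
      omega
  · rintro ⟨x', z⟩ h
    simp only [Finset.mem_product, neighbours, unitSteps, Fintype.mem_piFinset,
      Finset.mem_Icc, Finset.mem_insert, Finset.mem_singleton] at h
    refine Prod.ext (funext fun l => ?_) (funext fun ⟨l, hl⟩ => ?_)
    · simp only [glue, l.2, dif_neg, not_false_iff]
    · have := h.2 ⟨l, hl⟩
      simp only [glue, hl, dif_pos]
      omega
  · intro X h
    funext l
    by_cases hl : l ∈ A
    · simp [glue, hl]
    · simp [glue, hl]
  · rintro ⟨x', z⟩ h
    simp only [Finset.mem_product, neighbours, unitSteps, Fintype.mem_piFinset,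
      Finset.mem_Icc, Finset.mem_insert, Finset.mem_singleton] at h
    have hf : face (glue A x' fun l => (2 + z l).toNat) = face (glue A x' fun _ => 2) := by
      ext l
      by_cases hl : l ∈ A
      · have := h.2 ⟨l, hl⟩
        simp only [face, Finset.mem_filter, Finset.mem_univ, true_and, glue, hl, dif_pos]
        omega
      · simp [face, glue, hl]
    have hz : incr (glue A x fun _ => 2) (glue A x' fun l => (2 + z l).toNat)
        = glue A (incr x x') z := by
      funext l
      by_cases hl : l ∈ A
      · have := h.2 ⟨l, hl⟩
        simp only [incr, glue, hl, dif_pos]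
        omega
      · simp [incr, glue, hl]
    simp only [hz]
    rw [hf]

/-- The transition law of the induced chain of `A`. -/
noncomputable def induced (A : Finset (Fin d)) (y : L.InducedState A) :
    PMF (L.InducedState A) :=
  PMF.ofFinset
    (fun y' => if y'.1 ∈ neighbours y.1 then
      ∑ z ∈ unitSteps {l // l ∈ A},
        (L.p (glue A (incr y.1 y'.1) z) (face (glue A y.1 fun _ => 2))
          (face (glue A y'.1 fun _ => 2)) y.2 y'.2 : ℝ≥0∞) else 0)
    ((neighbours y.1).sigma fun _ => Finset.univ)
    (by
      rw [Finset.sum_sigma]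
      have h := L.sum_induced A y.1 y.2
      have h' := congrArg (fun r : ℝ≥0 => (r : ℝ≥0∞)) h
      simp only [ENNReal.ofNNReal_finsetSum, ENNReal.coe_one] at h'
      rw [← h']
      refine Finset.sum_congr rfl fun x' hx' => Finset.sum_congr rfl fun j _ => ?_
      simp [hx'])
    (by
      rintro ⟨x', j⟩ h
      have : x' ∉ neighbours y.1 := fun hx => h (by simp [hx])
      simp [this])

/-- The mean increment vector `a(A)` with respect to the stationary distribution of the
induced chain of `A`. -/
noncomputable def meanIncrement (A : Finset (Fin d)) (l : Fin d) : ℝ :=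
  ∑' y : L.InducedState A,
    L.drift (L.lift A y) l * (MarkovChain.stationaryDist (L.induced A) y).toReal

/-- The set `𝒲_A` of the vectors `w` that are positive on `A`, negative off `A`, and satisfy
`⟨a(B), w⟩ > 0` for each `B` meeting `A` whose induced chain is positive recurrent. -/
def escapeDirections (A : Finset (Fin d)) : Set (Fin d → ℝ) :=
  {w | (∀ l ∈ A, 0 < w l) ∧ (∀ l ∉ A, w l < 0) ∧
    ∀ B : Finset (Fin d), (B ∩ A).Nonempty →
      MarkovChain.IsPositiveRecurrent (L.induced B) →
        0 < ∑ l, L.meanIncrement B l * w l}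

end MMRRW

/-! ### Closed sets of an irreducible chain. -/

namespace MarkovChain

variable {S : Type*} {P : S → PMF S}

theorem IsIrreducible.eq_univ_of_closed (hP : IsIrreducible P) {C : Set S}
    (hC : ∀ x ∈ C, ∀ z, P x z ≠ 0 → z ∈ C) (hne : C.Nonempty) (y : S) : y ∈ C := by
  have key : ∀ n, ∀ x ∈ C, ∀ y, nStep P n x y ≠ 0 → y ∈ C := by
    intro n
    induction n with
    | zero =>
      intro x hx y hy
      rw [nStep, PMF.pure_apply] at hy
      by_cases h : y = x
      · exact h ▸ hx
      · simp [h] at hy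
    | succ n ih =>
      intro x hx y hy
      rw [nStep, PMF.bind_apply] at hy
      obtain ⟨z, hz⟩ : ∃ z, P x z * nStep P n z y ≠ 0 := by
        by_contra! h
        exact hy (ENNReal.tsum_eq_zero.2 h)
      exact ih z (hC x hx z (left_ne_zero_of_mul hz)) y (right_ne_zero_of_mul hz)
  obtain ⟨x, hx⟩ := hne
  obtain ⟨n, hn⟩ := hP x y
  exact key n x hx y hn.ne'

/-! ### Transience from superharmonic functions -/

/-- The probability that the chain started at `x` visits `y` at some positive time. -/
noncomputable def hitProb (P : S → PMF S) (y x : S) : ℝ≥0∞ :=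
  ∑' n : ℕ, firstPassage P y n x

-- First-step decomposition of the probability of a visit within `n + 1` steps; the finite horizon
-- is what permits induction in `hitProb_mul_le`.
open Classical in
theorem sum_firstPassage_succ (P : S → PMF S) (y x : S) (n : ℕ) :
    ∑ k ∈ Finset.range (n + 1), firstPassage P y k x
      = ∑' z, P x z * if z = y then 1 else ∑ k ∈ Finset.range n, firstPassage P y k z := by
  rw [Finset.sum_range_succ']
  simp only [firstPassage]
  rw [← Summable.tsum_finsetSum (fun _ _ => ENNReal.summable), add_comm]
  have h0 : P x y = ∑' z, if z = y then P x z else 0 := by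
    rw [tsum_eq_single y (by intro b hb; simp [hb])]; simp
  rw [h0, ← ENNReal.tsum_add]
  refine tsum_congr fun z => ?_
  by_cases h : z = y <;> simp [h, Finset.mul_sum]

open Classical in
theorem hitProb_eq (P : S → PMF S) (y x : S) :
    hitProb P y x = ∑' z, P x z * if z = y then 1 else hitProb P y z := by
  rw [hitProb, tsum_eq_zero_add' ENNReal.summable]
  simp only [firstPassage]
  rw [ENNReal.tsum_comm]
  have h0 : P x y = ∑' z, if z = y then P x z else 0 := by
    rw [tsum_eq_single y (by intro b hb; simp [hb])]; simp
  rw [h0, ← ENNReal.tsum_add]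
  refine tsum_congr fun z => ?_
  by_cases h : z = y <;> simp [h, hitProb, ENNReal.tsum_mul_left]

/-- Optional stopping at the first visit to `y`, done by induction on the horizon: superharmonicity
pays for the first step. -/
theorem hitProb_mul_le (y : S) {v : S → ℝ≥0∞}
    (hv : ∀ x, ∑' z, P x z * v z ≤ v x) (x : S) : hitProb P y x * v y ≤ v x := by
  classical
  rw [hitProb, ENNReal.tsum_eq_iSup_nat, ENNReal.iSup_mul]
  refine iSup_le fun n => ?_
  induction n generalizing x with
  | zero => simp
  | succ n ih =>
    rw [sum_firstPassage_succ, ← ENNReal.tsum_mul_right]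
    refine le_trans (ENNReal.tsum_le_tsum fun z => ?_) (hv x)
    rw [mul_assoc]
    gcongr
    by_cases h : z = y
    · simp [h]
    · simpa [h] using ih z

theorem hitProb_le_one (y x : S) : hitProb P y x ≤ 1 := by
  have := hitProb_mul_le (P := P) y (v := fun _ => 1) (by simp [PMF.tsum_coe]) x
  simpa using this

/-- If `u ≤ c` and the mean of `u` under `p` is at least `c`, then `u = c` where `p` has mass. -/
theorem eq_of_tsum_mul_ge {p : PMF S} {u : S → ℝ≥0∞} {c : ℝ≥0∞} (hc : c ≠ ∞)
    (hu : ∀ z, p z ≠ 0 → u z ≤ c) (h : c ≤ ∑' z, p z * u z) (z : S) (hz : p z ≠ 0) : u z = c := by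
  by_contra hne
  have hlt : ∑' z, p z * u z < ∑' z, p z * c := by
    refine ENNReal.tsum_lt_tsum (i := z) ?_ ?_ ?_
    · refine ne_top_of_le_ne_top hc ?_
      calc ∑' z, p z * u z ≤ ∑' z, p z * c := ENNReal.tsum_le_tsum fun a => by
            by_cases ha : p a = 0
            · simp [ha]
            · gcongr; exact hu a ha
        _ = c := by rw [ENNReal.tsum_mul_right, PMF.tsum_coe, one_mul]
    · intro a
      by_cases ha : p a = 0
      · simp [ha]
      · gcongr; exact hu a ha
    · exact (ENNReal.mul_lt_mul_iff_right hz (p.apply_ne_top z)).2 (lt_of_le_of_ne (hu z hz) hne)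
  rw [ENNReal.tsum_mul_right, PMF.tsum_coe, one_mul] at hlt
  exact absurd h (not_le.2 hlt)

/-- If the mean of `u ≥ c` under `p` is at most `c`, then `u = c` where `p` has mass. -/
theorem eq_of_tsum_mul_le {p : PMF S} {u : S → ℝ≥0∞} {c : ℝ≥0∞} (hc : c ≠ ∞)
    (hu : ∀ z, c ≤ u z) (h : ∑' z, p z * u z ≤ c) (z : S) (hz : p z ≠ 0) : u z = c := by
  by_contra hne
  have hlt : ∑' z, p z * c < ∑' z, p z * u z := by
    refine ENNReal.tsum_lt_tsum (i := z) ?_ (fun a => by gcongr; exact hu a) ?_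
    · rw [ENNReal.tsum_mul_right, PMF.tsum_coe, one_mul]; exact hc
    · exact (ENNReal.mul_lt_mul_iff_right hz (p.apply_ne_top z)).2
        (lt_of_le_of_ne (hu z) (Ne.symm hne))
  rw [ENNReal.tsum_mul_right, PMF.tsum_coe, one_mul] at hlt
  exact absurd h (not_le.2 hlt)

/-- A mean of numbers at most `1` equals `1` only if all of them do, so the value `1` propagates
from `y` along possible transitions. -/
theorem IsIrreducible.hitProb_eq_one (hP : IsIrreducible P) {y : S} (hy : returnProb P y = 1)
    (x : S) : hitProb P y x = 1 := by
  classical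
  refine hP.eq_univ_of_closed (C := {x | hitProb P y x = 1}) ?_ ⟨y, hy⟩ x
  intro x hx z hz
  by_cases hzy : z = y
  · rw [hzy]; exact hy
  rw [Set.mem_ofPred_eq, hitProb_eq] at hx
  have := eq_of_tsum_mul_ge (p := P x) (u := fun z => if z = y then 1 else hitProb P y z)
    ENNReal.one_ne_top (fun z _ => by
      split_ifs
      exacts [le_rfl, hitProb_le_one y z]) hx.ge z hz
  simpa [hzy] using this

/-- An irreducible chain with a finite nonconstant superharmonic function is transient. -/
theorem IsIrreducible.isTransient_of_superharmonic (hP : IsIrreducible P) {v : S → ℝ≥0∞}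
    (hfin : ∀ x, v x ≠ ∞) (hv : ∀ x, ∑' z, P x z * v z ≤ v x) {a b : S} (hab : v a ≠ v b) :
    IsTransient P := by
  intro y
  -- If `y` were recurrent it would be hit surely from everywhere, so `v` would attain its minimum
  -- at `y`; the set of minimizers of a superharmonic function is closed.
  refine lt_of_le_of_ne (hitProb_le_one y y) fun hy => hab ?_
  have hmin : ∀ x, v y ≤ v x := fun x => by
    simpa [hP.hitProb_eq_one hy x] using hitProb_mul_le y hv x
  have hconst : ∀ x, v x = v y := fun x =>
    hP.eq_univ_of_closed (C := {x | v x = v y}) (fun x hx z hz =>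
      eq_of_tsum_mul_le (hfin y) hmin ((hv x).trans hx.le) z hz) ⟨y, rfl⟩ x
  rw [hconst a, hconst b]

/-! ### Stationary distributions -/

open Classical in
/-- The probability that the chain started at `x` does not visit `y` at the times `1, …, n`. -/
noncomputable def avoidProb (P : S → PMF S) (y : S) : ℕ → S → ℝ≥0∞
  | 0, _ => 1
  | n + 1, x => ∑' z, if z = y then 0 else P x z * avoidProb P y n z

theorem avoidProb_eq (P : S → PMF S) (y : S) (n : ℕ) (x : S) :
    avoidProb P y n x = firstPassage P y n x + avoidProb P y (n + 1) x := by
  classical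
  induction n generalizing x with
  | zero =>
    simp only [avoidProb, firstPassage, mul_one]
    have h0 : P x y = ∑' z, if z = y then P x z else 0 := by
      rw [tsum_eq_single y (by intro b hb; simp [hb])]; simp
    rw [h0, ← ENNReal.tsum_add, ← PMF.tsum_coe (P x)]
    refine tsum_congr fun z => ?_
    by_cases h : z = y <;> simp [h]
  | succ n ih =>
    rw [avoidProb, firstPassage, avoidProb, ← ENNReal.tsum_add]
    refine tsum_congr fun z => ?_
    by_cases h : z = y
    · simp [h]
    · simp only [h, if_false]
      rw [ih z, mul_add]

theorem sum_firstPassage_add_avoidProb (P : S → PMF S) (y x : S) (n : ℕ) :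
    ∑ k ∈ Finset.range n, firstPassage P y k x + avoidProb P y n x = 1 := by
  induction n with
  | zero => simp [avoidProb]
  | succ n ih => rw [Finset.sum_range_succ, add_assoc, ← avoidProb_eq, ih]

/-- Summation by parts, the tail formula for the mean return time, with a boundary term that is
later discarded. -/
theorem sum_mul_firstPassage_add (P : S → PMF S) (y x : S) (n : ℕ) :
    ∑ k ∈ Finset.range n, ((k : ℝ≥0∞) + 1) * firstPassage P y k x + n * avoidProb P y n x
      = ∑ k ∈ Finset.range n, avoidProb P y k x := by
  induction n with
  | zero => simp
  | succ n ih =>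
    rw [Finset.sum_range_succ, Finset.sum_range_succ, ← ih, avoidProb_eq P y n x]
    push_cast
    ring

theorem IsStationary.tsum_mul {π : PMF S} (hπ : IsStationary P π) (x : S) :
    ∑' z, π z * P z x = π x := by
  rw [← PMF.bind_apply, hπ]

theorem IsStationary.apply_ne_zero {π : PMF S} (hπ : IsStationary P π) (hP : IsIrreducible P)
    (x : S) : π x ≠ 0 := by
  refine hP.eq_univ_of_closed (C := {x | π x ≠ 0}) (fun x hx z hz h0 => ?_) π.support_nonempty x
  rw [← hπ.tsum_mul z, ENNReal.tsum_eq_zero] at h0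
  exact mul_ne_zero hx hz (h0 x)

/-- Under the stationary law, avoiding `y` at times `1, …, n + 1` is as likely as avoiding it at
times `0, …, n`. Splitting on the position at time `0` makes the sum telescope. -/
theorem IsStationary.sum_avoidProb_le {π : PMF S} (hπ : IsStationary P π) (y : S) (n : ℕ) :
    π y * ∑ k ∈ Finset.range n, avoidProb P y k y ≤ 1 := by
  classical
  have step : ∀ n, ∑' x, π x * avoidProb P y n x
      = π y * avoidProb P y n y + ∑' x, π x * avoidProb P y (n + 1) x := by
    intro n
    have h1 : ∑' x, π x * avoidProb P y (n + 1) x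
        = ∑' z, if z = y then 0 else π z * avoidProb P y n z := by
      simp only [avoidProb, ← ENNReal.tsum_mul_left]
      rw [ENNReal.tsum_comm]
      refine tsum_congr fun z => ?_
      by_cases h : z = y
      · simp [h]
      · simp only [h, if_false, ← mul_assoc, ENNReal.tsum_mul_right, hπ.tsum_mul]
    have h0 : π y * avoidProb P y n y = ∑' z, if z = y then π z * avoidProb P y n z else 0 := by
      rw [tsum_eq_single y (by intro b hb; simp [hb])]; simp
    rw [h1, h0, ← ENNReal.tsum_add]
    refine tsum_congr fun z => ?_
    by_cases h : z = y <;> simp [h]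
  have tot : ∀ n, π y * ∑ k ∈ Finset.range n, avoidProb P y k y
      + ∑' x, π x * avoidProb P y n x = 1 := by
    intro n
    induction n with
    | zero => simp [avoidProb, PMF.tsum_coe]
    | succ n ih => rw [Finset.sum_range_succ, mul_add, add_assoc, ← step, ih]
  exact le_self_add.trans (tot n).le

/-- An irreducible chain with a stationary distribution is positive recurrent. -/
theorem IsStationary.isPositiveRecurrent {π : PMF S} (hπ : IsStationary P π)
    (hP : IsIrreducible P) : IsPositiveRecurrent P := by
  intro y
  have hy := hπ.apply_ne_zero hP y
  have hsum : ∑' k, avoidProb P y k y ≤ (π y)⁻¹ := by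
    rw [ENNReal.tsum_eq_iSup_nat]
    refine iSup_le fun n => ?_
    rw [ENNReal.le_inv_iff_mul_le, mul_comm]
    exact hπ.sum_avoidProb_le y n
  have hfin : ∑' k, avoidProb P y k y < ∞ :=
    hsum.trans_lt (ENNReal.inv_lt_top.2 (pos_iff_ne_zero.2 hy))
  constructor
  · have h1 := (ENNReal.tendsto_nat_tsum fun n => firstPassage P y n y).add
      (ENNReal.tendsto_atTop_zero_of_tsum_ne_top hfin.ne)
    simp only [sum_firstPassage_add_avoidProb, add_zero] at h1
    exact (tendsto_nhds_unique h1 tendsto_const_nhds)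
  · refine lt_of_le_of_lt ?_ hfin
    rw [meanReturnTime, ENNReal.tsum_eq_iSup_nat, ENNReal.tsum_eq_iSup_nat]
    refine iSup_mono fun n => ?_
    rw [← sum_mul_firstPassage_add]
    exact le_self_add

/-- Upgrades superinvariance to invariance for finite measures, since a transition kernel preserves
total mass. -/
theorem eq_of_le_of_tsum_le {m m' : S → ℝ≥0∞} (hle : ∀ x, m x ≤ m' x)
    (hfin : ∑' x, m x ≠ ∞) (htot : ∑' x, m' x ≤ ∑' x, m x) : m = m' := by
  funext x
  by_contra hne
  exact absurd htot (not_le.2 (ENNReal.tsum_lt_tsum hfin hle (lt_of_le_of_ne (hle x) hne)))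

theorem tsum_tsum_mul (P : S → PMF S) (m : S → ℝ≥0∞) :
    ∑' x, ∑' z, m z * P z x = ∑' z, m z := by
  rw [ENNReal.tsum_comm]
  simp [ENNReal.tsum_mul_left, PMF.tsum_coe]

/-- An irreducible chain has at most one stationary distribution. -/
theorem IsIrreducible.eq_of_isStationary (hP : IsIrreducible P) {π π' : PMF S}
    (hπ : IsStationary P π) (hπ' : IsStationary P π') : π = π' := by
  set m : S → ℝ≥0∞ := fun x => min (π x) (π' x) with hm
  have hmπ : ∀ x, m x ≤ π x := fun x => min_le_left _ _
  have hmπ' : ∀ x, m x ≤ π' x := fun x => min_le_right _ _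
  have hmfin : ∑' x, m x ≠ ∞ := ne_top_of_le_ne_top ENNReal.one_ne_top
    ((ENNReal.tsum_le_tsum hmπ).trans π.tsum_coe.le)
  -- The minimum of two invariant measures has image below itself, hence is invariant.
  have hmP : ∀ x, ∑' z, m z * P z x = m x := by
    refine congrFun (eq_of_le_of_tsum_le (fun x => le_min ?_ ?_) ?_ (tsum_tsum_mul P m).ge)
    · rw [← hπ.tsum_mul x]
      exact ENNReal.tsum_le_tsum fun z => by gcongr; exact hmπ z
    · rw [← hπ'.tsum_mul x]
      exact ENNReal.tsum_le_tsum fun z => by gcongr; exact hmπ' z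
    · rw [tsum_tsum_mul]; exact hmfin
  -- Strict inequality between the invariant measures `m ≤ π` propagates along transitions, so it
  -- holds nowhere or everywhere.
  have closed : ∀ π : PMF S, IsStationary P π → (∀ x, m x ≤ π x) →
      ∀ x, m x < π x → ∀ y, m y < π y := by
    intro π hπ hle x hx y
    refine hP.eq_univ_of_closed (C := {x | m x < π x}) (fun x hx z hz => ?_) ⟨x, hx⟩ y
    rw [Set.mem_ofPred_eq, ← hmP z, ← hπ.tsum_mul z]
    refine ENNReal.tsum_lt_tsum (i := x) ?_ (fun a => by gcongr; exact hle a) ?_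
    · rw [hmP z]; exact ne_top_of_le_ne_top (π.apply_ne_top z) (hle z)
    · exact (ENNReal.mul_lt_mul_iff_left hz ((P x).apply_ne_top z)).2 hx
  have fin : ∀ π : PMF S, ∑' x, π x ≠ ∞ := fun π => π.tsum_coe ▸ ENNReal.one_ne_top
  by_cases h : ∃ x, m x < π x
  · obtain ⟨x, hx⟩ := h
    have hlt := closed π hπ hmπ x hx
    have hm' : ∀ y, π' y ≤ π y := fun y => by
      have := hlt y
      rw [hm] at this
      rcases min_lt_iff.1 this with h | h
      · exact absurd h (lt_irrefl _)
      · exact h.le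
    refine (DFunLike.coe_injective (eq_of_le_of_tsum_le hm' (fin π') ?_)).symm
    rw [π.tsum_coe, π'.tsum_coe]
  · push Not at h
    have hm' : ∀ y, π y ≤ π' y := fun y => (h y).trans (hmπ' y)
    refine DFunLike.coe_injective (eq_of_le_of_tsum_le hm' (fin π) ?_)
    rw [π.tsum_coe, π'.tsum_coe]

theorem IsIrreducible.stationaryDist_eq (hP : IsIrreducible P) {π : PMF S}
    (hπ : IsStationary P π) : stationaryDist P = π := by
  have h : ∃ π : PMF S, IsStationary P π := ⟨π, hπ⟩
  rw [stationaryDist, dif_pos h, hP.eq_of_isStationary hπ h.choose_spec]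

/-- A finite nonzero superinvariant measure of an irreducible chain is a multiple of the
stationary distribution, and the chain is positive recurrent. -/
theorem IsIrreducible.of_superinvariant (hP : IsIrreducible P) {m : S → ℝ≥0∞}
    (h0 : ∑' x, m x ≠ 0) (hfin : ∑' x, m x ≠ ∞) (hm : ∀ x, ∑' z, m z * P z x ≤ m x) :
    IsPositiveRecurrent P ∧ ∀ x, m x = (∑' x, m x) * stationaryDist P x := by
  have hinv : ∀ x, ∑' z, m z * P z x = m x :=
    congrFun (eq_of_le_of_tsum_le hm (by rwa [tsum_tsum_mul]) (tsum_tsum_mul P m).ge)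
  have hst : IsStationary P (PMF.normalize m h0 hfin) := by
    refine PMF.ext fun x => ?_
    rw [PMF.bind_apply]
    simp only [PMF.normalize_apply]
    rw [← hinv x, ← ENNReal.tsum_mul_right]
    exact tsum_congr fun z => by ring
  refine ⟨hst.isPositiveRecurrent hP, fun x => ?_⟩
  rw [hP.stationaryDist_eq hst, PMF.normalize_apply, mul_comm, mul_assoc,
    ENNReal.inv_mul_cancel h0 hfin, mul_one]

end MarkovChain

section

open Filter Topology

/-! ### Positive functionals on a countable compact space -/

section Riesz

variable {X : Type*} [TopologicalSpace X]

open MeasureTheory in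
/-- A positive functional on the continuous functions on a countable compact space is given by
summable weights on the points. -/
theorem exists_weights [CompactSpace X] [T2Space X] [Countable X] (Λ : C(X, ℝ) →ₗ[ℝ] ℝ)
    (hΛ : ∀ φ : C(X, ℝ), 0 ≤ φ → 0 ≤ Λ φ) :
    ∃ m : X → ℝ, (∀ x, 0 ≤ m x) ∧ Summable m ∧ ∀ φ : C(X, ℝ), Λ φ = ∑' x, m x * φ x := by
  let _ : MeasurableSpace X := borel X
  have : BorelSpace X := ⟨rfl⟩
  -- On a compact space compact support is automatic, so the Riesz–Markov–Kakutani theorem applies;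
  -- countability turns the integral into a sum over points.
  let Λ₀ : CompactlySupportedContinuousMap X ℝ →ₗ[ℝ] ℝ :=
    { toFun := fun φ => Λ (φ : C(X, ℝ))
      map_add' := fun φ ψ => by rw [← map_add]; rfl
      map_smul' := fun c φ => by rw [RingHom.id_apply, ← map_smul]; rfl }
  let Λ' : CompactlySupportedContinuousMap X ℝ →ₚ[ℝ] ℝ :=
    PositiveLinearMap.mk₀ Λ₀ fun φ hφ => hΛ _ hφ
  set μ := RealRMK.rieszMeasure Λ' with hμ
  have hint : ∀ φ : C(X, ℝ), ∫ x, φ x ∂μ = Λ φ := fun φ =>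
    RealRMK.integral_rieszMeasure Λ' (CompactlySupportedContinuousMap.continuousMapEquiv φ)
  have hfin : IsFiniteMeasure μ := inferInstance
  refine ⟨fun x => μ.real {x}, fun x => measureReal_nonneg, ?_, fun φ => ?_⟩
  · have : ∑' x, μ {x} ≠ ∞ := by
      rw [← measure_iUnion (fun a b h => by simpa using h) (fun x => measurableSet_singleton x)]
      exact measure_ne_top _ _
    exact ENNReal.summable_toReal this
  · rw [← hint φ, integral_countable]
    · rfl
    · exact (φ.continuous.integrable_of_hasCompactSupport
        (HasCompactSupport.of_compactSpace _))

variable {S : Type*}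

/-- The functionals `Λ k` on the functions on `S` converge, on the continuous functions on a space
to which `S` is mapped by `e`, to the integration against the weights `m`. -/
structure IsWeightLimit (e : S → X) (Λ : ℕ → (S → ℝ) →ₗ[ℝ] ℝ) (𝓕 : Filter ℕ) (m : X → ℝ) :
    Prop where
  nonneg : ∀ x, 0 ≤ m x
  summable : Summable m
  tendsto : ∀ φ : C(X, ℝ), Tendsto (fun k => Λ k (φ ∘ e)) 𝓕 (𝓝 (∑' x, m x * φ x))

/-- Positive normalized functionals on the functions on `S` have a limit along an ultrafilter, on
the continuous functions on a countable compact space to which `S` is mapped. -/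
theorem exists_limit_weights [CompactSpace X] [T2Space X] [Countable X] (e : S → X)
    (Λ : ℕ → (S → ℝ) →ₗ[ℝ] ℝ) (hpos : ∀ k φ ψ, φ ≤ ψ → Λ k φ ≤ Λ k ψ) (hone : ∀ k, Λ k 1 = 1)
    (𝒰 : Ultrafilter ℕ) :
    ∃ m : X → ℝ, IsWeightLimit e Λ 𝒰 m := by
  have hconst : ∀ k (c : ℝ), Λ k (fun _ => c) = c := fun k c => by
    have : (fun _ => c : S → ℝ) = c • (1 : S → ℝ) := by ext; simp
    rw [this, map_smul, hone]; simp
  -- The values stay in `[-‖φ‖, ‖φ‖]`; the ultrafilter gives limits for all `φ` at once, with no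
  -- diagonal extraction.
  have hlim : ∀ φ : C(X, ℝ), ∃ a, Tendsto (fun k => Λ k (φ ∘ e)) 𝒰 (𝓝 a) := by
    intro φ
    have hb : ∀ k, Λ k (φ ∘ e) ∈ Set.Icc (-‖φ‖) ‖φ‖ := fun k => by
      have h := fun x => abs_le.1 (φ.norm_coe_le_norm (e x))
      constructor
      · rw [← hconst k (-‖φ‖)]; exact hpos k _ _ fun x => (h x).1
      · conv_rhs => rw [← hconst k ‖φ‖]
        exact hpos k _ _ fun x => (h x).2
    obtain ⟨a, -, ha⟩ := (isCompact_Icc (a := -‖φ‖) (b := ‖φ‖)).ultrafilter_le_nhds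
      (𝒰.map fun k => Λ k (φ ∘ e))
      (le_principal_iff.2 (Filter.mem_map.2 (univ_mem' hb)))
    exact ⟨a, ha⟩
  choose L hL using hlim
  let Λ' : C(X, ℝ) →ₗ[ℝ] ℝ :=
    { toFun := L
      map_add' := fun φ ψ => by
        refine tendsto_nhds_unique (hL (φ + ψ)) (((hL φ).add (hL ψ)).congr fun k => ?_)
        rw [← map_add]; rfl
      map_smul' := fun c φ => by
        refine tendsto_nhds_unique (hL (c • φ)) (((hL φ).const_mul c).congr fun k => ?_)
        rw [← smul_eq_mul, ← map_smul]; rfl }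
  obtain ⟨m, h0, hs, hm⟩ := exists_weights Λ' fun φ hφ => by
    refine ge_of_tendsto' (hL φ) fun k => ?_
    rw [← map_zero (Λ k)]
    exact hpos k _ _ fun x => hφ (e x)
  exact ⟨m, h0, hs, fun φ => hm φ ▸ hL φ⟩

namespace IsWeightLimit

variable {e : S → X} {Λ : ℕ → (S → ℝ) →ₗ[ℝ] ℝ} {𝓕 : Filter ℕ} {m : X → ℝ}

theorem tendsto_indicator (H : IsWeightLimit e Λ 𝓕 m) {U : Set X} (hU : IsClopen U) :
    Tendsto (fun k => Λ k ((e ⁻¹' U).indicator 1)) 𝓕 (𝓝 (∑' x, m x * U.indicator 1 x)) := by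
  have h := H.tendsto (LocallyConstant.charFn ℝ hU)
  simp only [LocallyConstant.coe_continuousMap, LocallyConstant.coe_charFn] at h
  exact h

theorem summable_mul_indicator (H : IsWeightLimit e Λ 𝓕 m) (U : Set X) :
    Summable fun x => m x * U.indicator 1 x :=
  Summable.of_nonneg_of_le
    (fun x => mul_nonneg (H.nonneg x) (Set.indicator_nonneg (fun _ _ => zero_le_one) _))
    (fun x => mul_le_of_le_one_right (H.nonneg x) (Set.indicator_le_self' (by simp) x)) H.summable

theorem le_tsum_indicator (H : IsWeightLimit e Λ 𝓕 m) {U : Set X} {p : X} (hp : p ∈ U) :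
    m p ≤ ∑' x, m x * U.indicator 1 x := by
  have h := (H.summable_mul_indicator U).le_tsum p fun x _ =>
    mul_nonneg (H.nonneg x) (Set.indicator_nonneg (fun _ _ => zero_le_one) _)
  simpa [hp] using h

theorem eq_zero_of_mem_isClopen [𝓕.NeBot] (H : IsWeightLimit e Λ 𝓕 m) {U : Set X}
    (hU : IsClopen U) {p : X} (hp : p ∈ U) (h : ∀ᶠ k in 𝓕, Λ k ((e ⁻¹' U).indicator 1) = 0) :
    m p = 0 := by
  refine le_antisymm ((H.le_tsum_indicator hp).trans (le_of_eq ?_)) (H.nonneg p)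
  exact tendsto_nhds_unique (H.tendsto_indicator hU)
    (tendsto_const_nhds.congr' (h.mono fun k hk => hk.symm))

theorem tsum_eq_one [𝓕.NeBot] (H : IsWeightLimit e Λ 𝓕 m) (hone : ∀ k, Λ k 1 = 1) :
    ∑' x, m x = 1 := by
  have h := H.tendsto 1
  simp only [ContinuousMap.one_apply, mul_one] at h
  refine tendsto_nhds_unique h (tendsto_const_nhds.congr fun k => ?_)
  exact (hone k).symm

end IsWeightLimit

end Riesz

end

/-! ### Superharmonic functions from a positive drift over several steps -/

section Drift

variable {S : Type*}

/-- The value of `T φ` at `y` is monotone in the values of `φ` at the points where `f` differs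
from `f y` by at most `c`. -/
def IsLocalMono (f : S → ℝ) (c : ℝ) (T : (S → ℝ) →ₗ[ℝ] (S → ℝ)) : Prop :=
  ∀ y φ ψ, (∀ y', |f y' - f y| ≤ c → φ y' ≤ ψ y') → T φ y ≤ T ψ y

variable {f : S → ℝ} {c : ℝ} {T : (S → ℝ) →ₗ[ℝ] (S → ℝ)}

theorem IsLocalMono.mono (hT : IsLocalMono f c T) {φ ψ : S → ℝ} (h : φ ≤ ψ) : T φ ≤ T ψ :=
  fun y => hT y φ ψ fun y' _ => h y'

theorem IsLocalMono.pow (hT : IsLocalMono f c T) (n : ℕ) : IsLocalMono f (n * c) (T ^ n) := by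
  induction n with
  | zero =>
    intro y φ ψ h
    simpa using h y (by simp)
  | succ n ih =>
    intro y φ ψ h
    rw [pow_succ', Module.End.mul_apply, Module.End.mul_apply]
    refine hT y _ _ fun y' hy' => ih y' _ _ fun y'' hy'' => h y'' ?_
    calc |f y'' - f y| ≤ |f y'' - f y'| + |f y' - f y| := abs_sub_le _ _ _
      _ ≤ _ := by push_cast; linarith

theorem pow_one_of (hone : T 1 = 1) (n : ℕ) : (T ^ n) 1 = 1 := by
  induction n with
  | zero => simp
  | succ n ih => rw [pow_succ', Module.End.mul_apply, ih, hone]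

theorem map_const_of (hone : T 1 = 1) (a : ℝ) : T (fun _ => a) = fun _ => a := by
  have : (fun _ => a : S → ℝ) = a • (1 : S → ℝ) := by ext; simp
  rw [this, map_smul, hone]

/-- Telescoping. It serves both to turn a decrease over `t` steps into superharmonicity and to
evaluate time averages of a drift. -/
theorem sum_pow_map_sub (T : (S → ℝ) →ₗ[ℝ] (S → ℝ)) (φ : S → ℝ) (n : ℕ) :
    ∑ k ∈ Finset.range n, (T ^ k) (T φ - φ) = (T ^ n) φ - φ := by
  induction n with
  | zero => simp
  | succ n ih =>
    rw [Finset.sum_range_succ, ih, map_sub, ← Module.End.mul_apply, ← pow_succ]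
    abel

/-- If the drift of `f` is at least `1`, and `f` changes by at most `c`, then the mean of
`exp (-δ f)` decreases for small `δ`. -/
theorem IsLocalMono.exp_le (hT : IsLocalMono f c T) (hone : T 1 = 1) {δ : ℝ} (hδ : 0 < δ)
    (h1 : δ * c ≤ 1) (h2 : δ * c ^ 2 ≤ 1) {y : S} (hy : 1 ≤ T f y - f y) :
    T (fun x => Real.exp (-δ * f x)) y ≤ Real.exp (-δ * f y) := by
  set E := Real.exp (-δ * f y) with hE
  have hEpos : 0 < E := Real.exp_pos _
  -- Within distance `c` of `f y`, `exp x ≤ 1 + x + x ^ 2` bounds the exponential by an affine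
  -- function of `f`, on which `T` is computed from the drift. The linear gain `δ` absorbs the error
  -- `δ ^ 2 * c ^ 2`.
  have hle : T (fun x => Real.exp (-δ * f x)) y
      ≤ T ((fun _ => E * (1 + δ * f y + δ ^ 2 * c ^ 2)) - (E * δ) • f) y := by
    refine hT y _ _ fun y' hy' => ?_
    have hc : 0 ≤ c := (abs_nonneg _).trans hy'
    have hx : |-(δ * (f y' - f y))| ≤ δ * c := by
      rw [abs_neg, abs_mul, abs_of_pos hδ]; gcongr
    have hexp := (abs_le.1 (Real.abs_exp_sub_one_sub_id_le (hx.trans h1))).2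
    have hsq : (-(δ * (f y' - f y))) ^ 2 ≤ (δ * c) ^ 2 := sq_le_sq' (abs_le.1 hx).1 (abs_le.1 hx).2
    have : Real.exp (-δ * f y') = E * Real.exp (-(δ * (f y' - f y))) := by
      rw [hE, ← Real.exp_add]; ring_nf
    rw [this]
    simp only [Pi.sub_apply, Pi.smul_apply, smul_eq_mul]
    have : Real.exp (-(δ * (f y' - f y))) ≤ 1 + δ * f y + δ ^ 2 * c ^ 2 - δ * f y' := by
      nlinarith
    calc E * Real.exp (-(δ * (f y' - f y))) ≤ E * (1 + δ * f y + δ ^ 2 * c ^ 2 - δ * f y') := by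
          gcongr
      _ = _ := by ring
  rw [map_sub, map_smul, map_const_of hone] at hle
  simp only [Pi.sub_apply, Pi.smul_apply, smul_eq_mul] at hle
  have h3 : δ ^ 2 * c ^ 2 ≤ δ := by nlinarith
  have : E * (1 + δ * f y + δ ^ 2 * c ^ 2) - E * δ * T f y
      ≤ E * 1 := by
    rw [mul_assoc, ← mul_sub]
    gcongr
    nlinarith
  linarith

/-- A positive drift over `t` steps where `f` is large yields a nonconstant nonnegative
superharmonic function. -/
theorem IsLocalMono.exists_superharmonic (hT : IsLocalMono f c T) (hone : T 1 = 1) (hc : 0 ≤ c)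
    {t : ℕ} (ht : 0 < t) {K : ℝ} (hdrift : ∀ y, K ≤ f y → 1 ≤ (T ^ t) f y - f y)
    {a b : S} (ha : f a ≤ 0) (hb : K < f b) (hb' : t * c < f b) :
    ∃ v : S → ℝ, 0 ≤ v ∧ T v ≤ v ∧ v a ≠ v b := by
  -- The bound `t * c` keeps the walk from `a` below the level `K'` during `t` steps.
  set K' := max K (t * c) with hK'
  have hbK : K' < f b := max_lt hb hb'
  have htc : 0 ≤ t * c := by positivity
  set δ := 1 / (1 + t * c) ^ 2 with hδ
  have hδpos : 0 < δ := by positivity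
  have h1 : δ * (t * c) ≤ 1 := by
    rw [hδ, div_mul_eq_mul_div, one_mul, div_le_one (by positivity)]; nlinarith
  have h2 : δ * (t * c) ^ 2 ≤ 1 := by
    rw [hδ, div_mul_eq_mul_div, one_mul, div_le_one (by positivity)]; nlinarith
  set M := Real.exp (-δ * K') with hM
  have hMpos : 0 < M := Real.exp_pos _
  -- Below the level `K'` the function `u` has its maximal value `M`, so no drift is needed there.
  set u : S → ℝ := fun x => min (Real.exp (-δ * f x)) M with hu
  have hu0 : 0 ≤ u := fun x => le_min (Real.exp_pos _).le hMpos.le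
  have huM : u ≤ fun _ => M := fun x => min_le_right _ _
  have hTt := hT.pow t
  have hdec : (T ^ t) u ≤ u := by
    intro y
    by_cases hy : K' ≤ f y
    · have huy : u y = Real.exp (-δ * f y) := min_eq_left (Real.exp_le_exp.2 (by nlinarith))
      rw [huy]
      exact (hTt.mono (fun x => min_le_left _ _) y).trans
        (hTt.exp_le (pow_one_of hone t) hδpos h1 h2 (hdrift y ((le_max_left _ _).trans hy)))
    · have huy : u y = M := min_eq_right (Real.exp_le_exp.2 (by push Not at hy; nlinarith))
      rw [huy]
      refine (hTt.mono huM y).trans (le_of_eq ?_)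
      rw [map_const_of (pow_one_of hone t)]
  have hpos : ∀ n, 0 ≤ (T ^ n) u := fun n => by
    have := (hT.pow n).mono hu0
    rwa [map_zero] at this
  have hub : ∀ n y, (T ^ n) u y ≤ M := fun n y => by
    have := (hT.pow n).mono huM y
    rwa [map_const_of (pow_one_of hone n)] at this
  -- For this sum `v`, `T v - v = T ^ t u - u ≤ 0`. At `a` every term is `M`; at `b` the term `n =
  -- 0` is smaller.
  refine ⟨∑ n ∈ Finset.range t, (T ^ n) u, Finset.sum_nonneg fun n _ => hpos n, ?_, ?_⟩
  · have h := sum_pow_map_sub T u t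
    have : T (∑ n ∈ Finset.range t, (T ^ n) u) - ∑ n ∈ Finset.range t, (T ^ n) u
        = (T ^ t) u - u := by
      rw [← h, map_sum, ← Finset.sum_sub_distrib]
      refine Finset.sum_congr rfl fun k _ => ?_
      rw [map_sub, ← Module.End.mul_apply, ← Module.End.mul_apply, ← pow_succ, ← pow_succ']
    rw [← sub_nonpos, this, sub_nonpos]
    exact hdec
  · have hva : (∑ n ∈ Finset.range t, (T ^ n) u) a = ∑ n ∈ Finset.range t, M := by
      rw [Finset.sum_apply]
      refine Finset.sum_congr rfl fun n hn => le_antisymm (hub n a) ?_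
      have := hT.pow n a (fun _ => M) u fun y' hy' => by
        refine le_min (Real.exp_le_exp.2 ?_) le_rfl
        have h4 := (abs_le.1 hy').2
        have h5 : (n : ℝ) * c ≤ t * c := by
          gcongr; exact (Finset.mem_range.1 hn).le
        have h6 : t * c ≤ K' := le_max_right _ _
        nlinarith
      rwa [map_const_of (pow_one_of hone n)] at this
    have hvb : (∑ n ∈ Finset.range t, (T ^ n) u) b < ∑ n ∈ Finset.range t, M := by
      rw [Finset.sum_apply]
      refine Finset.sum_lt_sum (fun n _ => hub n b) ⟨0, Finset.mem_range.2 ht, ?_⟩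
      simp only [pow_zero, Module.End.one_apply]
      exact (min_le_left _ _).trans_lt (Real.exp_lt_exp.2 (by nlinarith))
    rw [hva]
    exact hvb.ne'

end Drift

namespace MMRRW

variable {d : ℕ} (L : MMRRW d)

/-! ### The one-step expectation operator -/

/-- The background states of all the faces. -/
abbrev Label : Type := Σ A : Finset (Fin d), Fin (L.s A)

/-- The face and background state of a state of the walk. -/
def label (y : L.State) : L.Label := ⟨face y.1, y.2⟩

/-- The transition probability by the increment `z`, as a real number. -/
def weight (z : Fin d → ℤ) (a b : L.Label) : ℝ := (L.p z a.1 b.1 a.2 b.2 : ℝ)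

variable {L} in
theorem weight_nonneg (z : Fin d → ℤ) (a b : L.Label) : 0 ≤ L.weight z a b := NNReal.coe_nonneg _

/-- The operator sending `φ` to the function whose value at `y` is the mean of `φ` after one step
from `y`. -/
noncomputable def step : (L.State → ℝ) →ₗ[ℝ] (L.State → ℝ) where
  toFun φ y := ∑ x' ∈ neighbours y.1, ∑ j : Fin (L.s (face x')),
    L.weight (incr y.1 x') (L.label y) ⟨face x', j⟩ * φ ⟨x', j⟩
  map_add' φ ψ := by
    ext y
    simp only [Pi.add_apply, mul_add, Finset.sum_add_distrib]
  map_smul' a φ := by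
    ext y
    simp only [Pi.smul_apply, smul_eq_mul, RingHom.id_apply, Finset.mul_sum]
    exact Finset.sum_congr rfl fun _ _ => Finset.sum_congr rfl fun _ _ => by ring

theorem step_apply (φ : L.State → ℝ) (y : L.State) :
    L.step φ y = ∑ x' ∈ neighbours y.1, ∑ j : Fin (L.s (face x')),
      L.weight (incr y.1 x') (L.label y) ⟨face x', j⟩ * φ ⟨x', j⟩ := rfl

theorem step_one : L.step 1 = 1 := by
  ext ⟨x, i⟩
  have h := congrArg (fun r : ℝ≥0 => (r : ℝ)) (L.sum_p x i)
  simp only [NNReal.coe_sum, NNReal.coe_one] at h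
  simpa [step_apply, weight, label] using h

theorem step_mono {φ ψ : L.State → ℝ} {y : L.State}
    (h : ∀ y' : L.State, y'.1 ∈ neighbours y.1 → φ y' ≤ ψ y') : L.step φ y ≤ L.step ψ y := by
  rw [step_apply, step_apply]
  exact Finset.sum_le_sum fun x' hx' => Finset.sum_le_sum fun j _ =>
    mul_le_mul_of_nonneg_left (h ⟨x', j⟩ hx') (weight_nonneg _ _ _)

theorem chain_apply (y y' : L.State) : L.chain y y' = if y'.1 ∈ neighbours y.1 then
    ENNReal.ofReal (L.weight (incr y.1 y'.1) (L.label y) (L.label y')) else 0 := by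
  rw [chain, PMF.ofFinset_apply]
  simp [weight, label]

theorem chain_apply_eq_zero {y y' : L.State}
    (h : y' ∉ (neighbours y.1).sigma fun x => (Finset.univ : Finset (Fin (L.s (face x))))) :
    L.chain y y' = 0 := by
  rw [chain_apply, if_neg]
  exact fun hx => h (by simp [hx])

theorem tsum_chain_mul_ofReal {v : L.State → ℝ} (hv : 0 ≤ v) (y : L.State) :
    ∑' y', L.chain y y' * ENNReal.ofReal (v y') = ENNReal.ofReal (L.step v y) := by
  rw [tsum_eq_sum (s := (neighbours y.1).sigma fun _ => Finset.univ)
    (fun y' hy' => by rw [L.chain_apply_eq_zero hy', zero_mul]), Finset.sum_sigma, step_apply,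
    ENNReal.ofReal_sum_of_nonneg fun x' _ => Finset.sum_nonneg fun j _ =>
      mul_nonneg (weight_nonneg _ _ _) (hv _)]
  refine Finset.sum_congr rfl fun x' hx' => ?_
  rw [ENNReal.ofReal_sum_of_nonneg fun j _ => mul_nonneg (weight_nonneg _ _ _) (hv _)]
  refine Finset.sum_congr rfl fun j _ => ?_
  rw [chain_apply, if_pos hx', ENNReal.ofReal_mul (weight_nonneg _ _ _)]
  rfl

theorem drift_eq (y : L.State) (l : Fin d) :
    L.drift y l = L.step (fun y' => (y'.1 l : ℝ) - (y.1 l : ℝ)) y := by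
  rw [drift, tsum_eq_sum (s := (neighbours y.1).sigma fun _ => Finset.univ)
    (fun y' hy' => by rw [L.chain_apply_eq_zero hy', ENNReal.toReal_zero, zero_mul]),
    Finset.sum_sigma, step_apply]
  refine Finset.sum_congr rfl fun x' hx' => Finset.sum_congr rfl fun j _ => ?_
  rw [chain_apply, if_pos hx', ENNReal.toReal_ofReal (weight_nonneg _ _ _)]
  rfl

theorem abs_sub_le_one_of_mem_neighbours {ι : Type*} [Fintype ι] [DecidableEq ι] {x x' : ι → ℕ}
    (h : x' ∈ neighbours x) (l : ι) : |(x' l : ℝ) - x l| ≤ 1 := by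
  have := Finset.mem_Icc.1 (Fintype.mem_piFinset.1 h l)
  have h2 : |(x' l : ℤ) - x l| ≤ 1 := abs_le.2 ⟨by omega, by omega⟩
  exact_mod_cast h2

theorem abs_drift_le (y : L.State) (l : Fin d) : |L.drift y l| ≤ 1 := by
  rw [drift_eq]
  have h1 := L.step_mono (y := y) (φ := fun y' => (y'.1 l : ℝ) - (y.1 l : ℝ)) (ψ := fun _ => 1)
    fun y' hy' => (abs_le.1 (abs_sub_le_one_of_mem_neighbours hy' l)).2
  have h2 := L.step_mono (y := y) (ψ := fun y' => (y'.1 l : ℝ) - (y.1 l : ℝ)) (φ := fun _ => -1)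
    fun y' hy' => (abs_le.1 (abs_sub_le_one_of_mem_neighbours hy' l)).1
  rw [map_const_of L.step_one] at h1 h2
  exact abs_le.2 ⟨h2, h1⟩

/-! ### The linear function of the front process -/

/-- The function `⟨x, w⟩` of the state `(x, i)`. -/
def height (w : Fin d → ℝ) (y : L.State) : ℝ := ∑ l, (y.1 l : ℝ) * w l

theorem isLocalMono_step (w : Fin d → ℝ) : IsLocalMono (L.height w) (∑ l, |w l|) L.step := by
  intro y φ ψ h
  refine L.step_mono fun y' hy' => h y' ?_
  rw [height, height, ← Finset.sum_sub_distrib]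
  refine (Finset.abs_sum_le_sum_abs _ _).trans (Finset.sum_le_sum fun l _ => ?_)
  rw [← sub_mul, abs_mul]
  exact mul_le_of_le_one_left (abs_nonneg _) (abs_sub_le_one_of_mem_neighbours hy' l)

theorem sum_drift_mul (w : Fin d → ℝ) (y : L.State) :
    ∑ l, L.drift y l * w l = L.step (L.height w) y - L.height w y := by
  have h : L.height w - (fun _ => L.height w y)
      = ∑ l, w l • fun y' : L.State => (y'.1 l : ℝ) - (y.1 l : ℝ) := by
    ext y'
    simp only [Pi.sub_apply, Finset.sum_apply, Pi.smul_apply, smul_eq_mul, height,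
      ← Finset.sum_sub_distrib]
    exact Finset.sum_congr rfl fun l _ => by ring
  have h' := congrFun (congrArg L.step h) y
  rw [map_sub, map_const_of L.step_one, map_sum, Finset.sum_apply, Pi.sub_apply] at h'
  rw [h']
  refine Finset.sum_congr rfl fun l _ => ?_
  rw [map_smul, drift_eq, Pi.smul_apply, smul_eq_mul, mul_comm]

/-- The mean increment of `⟨x, w⟩` from the point `x`, computed with the transition probabilities
out of the background state `b`. -/
noncomputable def heightDrift (w : Fin d → ℝ) (x : Fin d → ℕ) (b : L.Label) : ℝ :=
  ∑ x' ∈ neighbours x, (∑ j : Fin (L.s (face x')), L.weight (incr x x') b ⟨face x', j⟩) *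
    ∑ l, (incr x x' l : ℝ) * w l

theorem heightDrift_label (w : Fin d → ℝ) (y : L.State) :
    L.heightDrift w y.1 (L.label y) = L.step (L.height w) y - L.height w y := by
  have h := congrFun (map_sub L.step (L.height w) fun _ => L.height w y) y
  rw [map_const_of L.step_one, Pi.sub_apply] at h
  rw [← h, step_apply, heightDrift]
  refine Finset.sum_congr rfl fun x' _ => ?_
  rw [Finset.sum_mul]
  refine Finset.sum_congr rfl fun j _ => ?_
  congr 1
  simp only [Pi.sub_apply, height, ← Finset.sum_sub_distrib, incr]
  exact Finset.sum_congr rfl fun l _ => by push_cast; ring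

theorem mem_neighbours {ι : Type*} [Fintype ι] [DecidableEq ι] {x x' : ι → ℕ} :
    x' ∈ neighbours x ↔ ∀ l, x l - 1 ≤ x' l ∧ x' l ≤ x l + 1 := by
  simp [neighbours]

/-- The point matters only through which decrements are allowed and which coordinates vanish after
the jump. A coordinate at least `2` stays positive, whereas `1` may drop to `0`; hence the threshold
`2`. -/
theorem heightDrift_congr (w : Fin d → ℝ) {x₁ x₂ : Fin d → ℕ}
    (h : ∀ l, min (x₁ l) 2 = min (x₂ l) 2) (b : L.Label) :
    L.heightDrift w x₁ b = L.heightDrift w x₂ b := by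
  refine Finset.sum_bij' (fun x' _ l => x₂ l + x' l - x₁ l) (fun x' _ l => x₁ l + x' l - x₂ l)
    ?_ ?_ ?_ ?_ ?_
  · intro x' hx'
    rw [mem_neighbours] at hx' ⊢
    intro l
    have := h l; have := hx' l
    omega
  · intro x' hx'
    rw [mem_neighbours] at hx' ⊢
    intro l
    have := h l; have := hx' l
    omega
  · intro x' hx'
    rw [mem_neighbours] at hx'
    funext l
    beta_reduce
    have := h l; have := hx' l
    omega
  · intro x' hx'
    rw [mem_neighbours] at hx'
    funext l
    beta_reduce
    have := h l; have := hx' l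
    omega
  · intro x' hx'
    rw [mem_neighbours] at hx'
    have hi : incr x₂ (fun l => x₂ l + x' l - x₁ l) = incr x₁ x' := by
      funext l
      have := h l; have := hx' l
      simp only [incr]
      omega
    have hf : face (fun l => x₂ l + x' l - x₁ l) = face x' := by
      ext l
      have := h l; have := hx' l
      simp only [face, Finset.mem_filter, Finset.mem_univ, true_and]
      omega
    rw [hi, hf]

end MMRRW

namespace MMRRW

variable {d : ℕ} (L : MMRRW d)

/-! ### Comparison of the walk with the induced chains -/

theorem induced_apply_toReal (B : Finset (Fin d)) (q' q : L.InducedState B) :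
    (L.induced B q' q).toReal = if q.1 ∈ neighbours q'.1 then
      ∑ z ∈ unitSteps {l // l ∈ B}, L.weight (glue B (incr q'.1 q.1) z)
        (L.label (L.lift B q')) (L.label (L.lift B q)) else 0 := by
  rw [induced, PMF.ofFinset_apply]
  split_ifs
  · rw [ENNReal.toReal_sum fun _ _ => ENNReal.coe_ne_top]
    rfl
  · rfl

theorem glue_mem {β : Type*} {B : Finset (Fin d)} (u : {l // l ∉ B} → β) (v : {l // l ∈ B} → β)
    {l : Fin d} (h : l ∈ B) : glue B u v l = v ⟨l, h⟩ := dif_pos h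

theorem glue_notMem {β : Type*} {B : Finset (Fin d)} (u : {l // l ∉ B} → β)
    (v : {l // l ∈ B} → β) {l : Fin d} (h : l ∉ B) : glue B u v l = u ⟨l, h⟩ := dif_neg h

/-- The states of the walk that look like the state `q` of the induced chain of `B`, with the
coordinates in `B` at least `M`. -/
def stateCylinder (B : Finset (Fin d)) (M : ℕ) (q : L.InducedState B) : Set L.State :=
  {y | (∀ l : {l // l ∉ B}, y.1 l = q.1 l) ∧ (∀ l ∈ B, M ≤ y.1 l) ∧
    L.label y = L.label (L.lift B q)}

/-- Selects one background state by comparing labels, which avoids transport along the equality of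
faces. -/
theorem sum_label_ite (C : Finset (Fin d)) (b : L.Label) (F : L.Label → ℝ) (h : C = b.1) :
    ∑ j : Fin (L.s C), F ⟨C, j⟩ * (if (⟨C, j⟩ : L.Label) = b then 1 else 0) = F b := by
  obtain ⟨D, i⟩ := b
  subst h
  rw [Finset.sum_eq_single i]
  · simp
  · intro j _ hj
    simp [hj]
  · simp

/-- Each increment of the coordinates in `B` gives a distinct target. Coordinates at least `M + 1`
remain at least `M ≥ 1`, so the face is that of the induced chain. Other targets only add to the
right side. -/
theorem induced_le_step (B : Finset (Fin d)) {M : ℕ} (hM : 1 ≤ M) (q' q : L.InducedState B)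
    {y : L.State} (hy : y ∈ L.stateCylinder B (M + 1) q') :
    (L.induced B q' q).toReal ≤ L.step ((L.stateCylinder B M q).indicator 1) y := by
  classical
  obtain ⟨hu, hB, hlab⟩ := hy
  have hnn : ∀ x' ∈ neighbours y.1, 0 ≤ ∑ j : Fin (L.s (face x')),
      L.weight (incr y.1 x') (L.label y) ⟨face x', j⟩ *
        (L.stateCylinder B M q).indicator 1 (⟨x', j⟩ : L.State) := fun x' _ =>
    Finset.sum_nonneg fun j _ => mul_nonneg (weight_nonneg _ _ _)
      (Set.indicator_nonneg (fun _ _ => zero_le_one) _)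
  rw [induced_apply_toReal, step_apply]
  split_ifs with hq
  swap
  · exact Finset.sum_nonneg hnn
  rw [mem_neighbours] at hq
  set g : ({l // l ∈ B} → ℤ) → Fin d → ℕ := fun z => glue B q.1 fun l => (y.1 l + z l).toNat
  have hz : ∀ z ∈ unitSteps {l // l ∈ B}, ∀ l, z l = -1 ∨ z l = 0 ∨ z l = 1 := by
    intro z hz l
    simpa [unitSteps] using Fintype.mem_piFinset.1 hz l
  have hginj : Set.InjOn g (unitSteps {l // l ∈ B}) := by
    intro z hz1 z' hz2 h
    funext ⟨l, hl⟩
    have h1 := congrFun h l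
    simp only [g, glue_mem _ _ hl] at h1
    have := hz z hz1 ⟨l, hl⟩; have := hz z' hz2 ⟨l, hl⟩; have := hB l hl
    omega
  have hgmem : ∀ z ∈ unitSteps {l // l ∈ B}, g z ∈ neighbours y.1 := by
    intro z hz1
    rw [mem_neighbours]
    intro l
    by_cases hl : l ∈ B
    · simp only [g, glue_mem _ _ hl]
      have := hz z hz1 ⟨l, hl⟩; have := hB l hl
      omega
    · simp only [g, glue_notMem _ _ hl]
      have := hq ⟨l, hl⟩; have : y.1 l = q'.1 ⟨l, hl⟩ := hu ⟨l, hl⟩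
      omega
  refine le_trans ?_ (Finset.sum_le_sum_of_subset_of_nonneg
    (Finset.image_subset_iff.2 hgmem) fun x' hx' _ => hnn x' hx')
  rw [Finset.sum_image hginj]
  refine Finset.sum_le_sum fun z hz1 => le_of_eq ?_
  have hface : face (g z) = (L.label (L.lift B q)).1 := by
    ext l
    simp only [label, lift, face, Finset.mem_filter, Finset.mem_univ, true_and]
    by_cases hl : l ∈ B
    · simp only [g, glue_mem _ _ hl]
      have := hz z hz1 ⟨l, hl⟩; have := hB l hl
      omega
    · simp only [g, glue_notMem _ _ hl]
  have hincr : incr y.1 (g z) = glue B (incr q'.1 q.1) z := by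
    funext l
    by_cases hl : l ∈ B
    · simp only [g, incr, glue_mem _ _ hl]
      have := hz z hz1 ⟨l, hl⟩; have := hB l hl
      omega
    · simp only [g, incr, glue_notMem _ _ hl]
      rw [hu ⟨l, hl⟩]
  rw [← L.sum_label_ite (face (g z)) _ (fun b => L.weight _ _ b) hface]
  refine Finset.sum_congr rfl fun j _ => ?_
  rw [hincr, hlab]
  congr 1
  have hcyl : (⟨g z, j⟩ : L.State) ∈ L.stateCylinder B M q ↔
      (⟨face (g z), j⟩ : L.Label) = L.label (L.lift B q) := by
    refine ⟨fun h => h.2.2, fun h => ⟨fun l => ?_, fun l hl => ?_, h⟩⟩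
    · simp only [g, glue_notMem _ _ l.2]
    · simp only [g, glue_mem _ _ hl]
      have := hz z hz1 ⟨l, hl⟩; have := hB l hl
      omega
  simp only [Set.indicator_apply, hcyl, Pi.one_apply]

theorem eq_of_mem_stateCylinder {B : Finset (Fin d)} {M : ℕ} {q q' : L.InducedState B}
    {y : L.State} (h : y ∈ L.stateCylinder B M q) (h' : y ∈ L.stateCylinder B M q') : q = q' := by
  obtain ⟨u, i⟩ := q
  obtain ⟨u', i'⟩ := q'
  have hu : u = u' := funext fun l => (h.1 l).symm.trans (h'.1 l)
  subst hu
  have := h.2.2.symm.trans h'.2.2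
  simp only [label, lift, Sigma.mk.injEq, heq_eq_eq, true_and] at this
  rw [this]

/-- Cylinders of distinct states are disjoint, so at most one term is nonzero. -/
theorem sum_induced_mul_le_step (B : Finset (Fin d)) {M : ℕ} (hM : 1 ≤ M)
    (F : Finset (L.InducedState B)) (q : L.InducedState B) (y : L.State) :
    ∑ q' ∈ F, (L.induced B q' q).toReal * (L.stateCylinder B (M + 1) q').indicator 1 y
      ≤ L.step ((L.stateCylinder B M q).indicator 1) y := by
  by_cases h : ∃ q' ∈ F, y ∈ L.stateCylinder B (M + 1) q'
  · obtain ⟨q', hF, hy⟩ := h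
    rw [Finset.sum_eq_single_of_mem q' hF fun p _ hp => ?_]
    · rw [Set.indicator_of_mem hy]
      simpa using L.induced_le_step B hM q' q hy
    · rw [Set.indicator_of_notMem fun hyp => hp (L.eq_of_mem_stateCylinder hyp hy), mul_zero]
  · push Not at h
    rw [Finset.sum_eq_zero fun p hp => by rw [Set.indicator_of_notMem (h p hp), mul_zero]]
    have := L.step_mono (y := y) (φ := 0) (ψ := (L.stateCylinder B M q).indicator 1)
      fun y' _ => Set.indicator_nonneg (fun _ _ => zero_le_one) _
    simpa using this

end MMRRW

namespace MMRRW

open Filter Topology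

variable {d : ℕ} (L : MMRRW d)

/-! ### The compactified state space -/

/-- The space of the pairs of a point of the orthant, possibly with infinite coordinates, and a
background state of any face. -/
abbrev Extended : Type := (Fin d → ℕ∞) × L.Label

/-- The state space as a subset of its compactification. -/
def embed (y : L.State) : L.Extended := (fun l => (y.1 l : ℕ∞), L.label y)

/-- The state `(u, i)` of the induced chain of `B` as the point `((u, ∞), i)` at infinity. -/
def limitPoint (q : Σ B, L.InducedState B) : L.Extended :=
  (glue q.1 (fun l => (q.2.1 l : ℕ∞)) fun _ => ⊤, L.label (L.lift q.1 q.2))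

/-- The points near the limit point of `q` whose coordinates in `B` are at least `M`. -/
def cylinder (B : Finset (Fin d)) (M : ℕ) (q : L.InducedState B) : Set L.Extended :=
  {p | (∀ l : {l // l ∉ B}, p.1 l = q.1 l) ∧ (∀ l ∈ B, (M : ℕ∞) ≤ p.1 l) ∧
    p.2 = L.label (L.lift B q)}

theorem isClopen_singleton_natCast (n : ℕ) : IsClopen ({(n : ℕ∞)} : Set ℕ∞) :=
  ⟨isClosed_singleton, ENat.isOpen_singleton (ENat.natCast_ne_top n)⟩

theorem isClopen_Ici_natCast (n : ℕ) : IsClopen (Set.Ici (n : ℕ∞)) := by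
  refine ⟨isClosed_Ici, ?_⟩
  cases n with
  | zero =>
    have : Set.Ici ((0 : ℕ) : ℕ∞) = Set.univ := by ext; simp
    rw [this]; exact isOpen_univ
  | succ n =>
    have : Set.Ici ((n + 1 : ℕ) : ℕ∞) = Set.Ioi (n : ℕ∞) := by
      ext a
      simp only [Set.mem_Ici, Set.mem_Ioi, Nat.cast_add, Nat.cast_one]
      exact ENat.add_one_le_iff (ENat.natCast_ne_top n)
    rw [this]; exact isOpen_Ioi

theorem isClopen_label (b : L.Label) : IsClopen {p : L.Extended | p.2 = b} :=
  (isClopen_discrete {b}).preimage continuous_snd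

theorem isClopen_coord (l : Fin d) {s : Set ℕ∞} (hs : IsClopen s) :
    IsClopen {p : L.Extended | p.1 l ∈ s} :=
  hs.preimage ((continuous_apply l).comp continuous_fst)

theorem isClopen_cylinder (B : Finset (Fin d)) (M : ℕ) (q : L.InducedState B) :
    IsClopen (L.cylinder B M q) := by
  have h1 : IsClopen (⋂ l : {l // l ∉ B}, {p : L.Extended | p.1 l ∈ ({(q.1 l : ℕ∞)} : Set ℕ∞)}) :=
    isClopen_iInter_of_finite fun l => L.isClopen_coord l (isClopen_singleton_natCast _)
  have h2 : IsClopen (⋂ l ∈ B, {p : L.Extended | p.1 l ∈ Set.Ici (M : ℕ∞)}) :=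
    isClopen_biInter_finset fun l _ => L.isClopen_coord l (isClopen_Ici_natCast _)
  convert h1.inter (h2.inter (L.isClopen_label (L.label (L.lift B q)))) using 1
  ext p
  simp [cylinder]

theorem preimage_cylinder (B : Finset (Fin d)) (M : ℕ) (q : L.InducedState B) :
    L.embed ⁻¹' L.cylinder B M q = L.stateCylinder B M q := by
  ext y
  simp [cylinder, stateCylinder, embed]

theorem limitPoint_mem_cylinder (B : Finset (Fin d)) (M : ℕ) (q : L.InducedState B) :
    L.limitPoint ⟨B, q⟩ ∈ L.cylinder B M q := by
  refine ⟨fun l => ?_, fun l hl => ?_, rfl⟩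
  · simp only [limitPoint, glue_notMem _ _ l.2]
  · simp only [limitPoint, glue_mem _ _ hl, le_top]

theorem eq_limitPoint_of_forall_mem {B : Finset (Fin d)} {q : L.InducedState B} {p : L.Extended}
    (h : ∀ M, p ∈ L.cylinder B M q) : p = L.limitPoint ⟨B, q⟩ := by
  refine Prod.ext (funext fun l => ?_) (h 0).2.2
  by_cases hl : l ∈ B
  · simp only [limitPoint, glue_mem _ _ hl]
    exact ENat.eq_top_iff_forall_ge.2 fun M => (h M).2.1 l hl
  · simp only [limitPoint, glue_notMem _ _ hl]
    exact (h 0).1 ⟨l, hl⟩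

theorem limitPoint_fst_eq_top (q : Σ B, L.InducedState B) (l : Fin d) :
    (L.limitPoint q).1 l = ⊤ ↔ l ∈ q.1 := by
  by_cases hl : l ∈ q.1
  · simp only [limitPoint, glue_mem _ _ hl, hl]
  · simp only [limitPoint, glue_notMem _ _ hl, hl, iff_false]
    exact ENat.natCast_ne_top _

theorem limitPoint_injective : Function.Injective L.limitPoint := by
  rintro ⟨B, u, i⟩ ⟨B', u', i'⟩ h
  have hB : B = B' := by
    ext l
    rw [← L.limitPoint_fst_eq_top ⟨B, u, i⟩ l, h, L.limitPoint_fst_eq_top]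
  subst hB
  have hu : u = u' := by
    funext l
    have h1 := congrFun (congrArg Prod.fst h) l
    simp only [limitPoint, glue_notMem _ _ l.2] at h1
    exact_mod_cast h1
  subst hu
  have h2 := congrArg Prod.snd h
  simp only [limitPoint, label, lift, Sigma.mk.injEq, heq_eq_eq, true_and] at h2
  rw [h2]

theorem mem_range_limitPoint {p : L.Extended} (hp : ∀ l, l ∈ p.2.1 ↔ p.1 l ≠ 0) :
    p ∈ Set.range L.limitPoint := by
  classical
  obtain ⟨x, C, i⟩ := p
  set B : Finset (Fin d) := Finset.univ.filter fun l => x l = ⊤ with hB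
  set u : {l // l ∉ B} → ℕ := fun l => (x l).toNat with hu
  have hu' : ∀ l (hl : l ∉ B), ((u ⟨l, hl⟩ : ℕ) : ℕ∞) = x l := fun l hl =>
    ENat.natCast_toNat (by simpa [hB] using hl)
  have htop : ∀ l, l ∈ B → x l = ⊤ := fun l hl => by simpa [hB] using hl
  have hC : C = face (glue B u fun _ => 2) := by
    ext l
    rw [hp l]
    simp only [face, Finset.mem_filter, Finset.mem_univ, true_and]
    by_cases hl : l ∈ B
    · rw [glue_mem _ _ hl, htop l hl]; simp
    · rw [glue_notMem _ _ hl, ← hu' l hl]; simp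
  subst hC
  refine ⟨⟨B, u, i⟩, Prod.ext (funext fun l => ?_) rfl⟩
  by_cases hl : l ∈ B
  · simp only [limitPoint, glue_mem _ _ hl, htop l hl]
  · simp only [limitPoint, glue_notMem _ _ hl, hu' l hl]

/-! ### Limits of occupation functionals -/

variable {L} {Λ : ℕ → (L.State → ℝ) →ₗ[ℝ] ℝ} {𝓕 : Filter ℕ} [𝓕.NeBot] {m : L.Extended → ℝ}

/-- Such a point has a label that contradicts the vanishing or not of some coordinate. This
contradiction is a clopen condition met by no state of the walk. -/
theorem eq_zero_of_notMem_range (H : IsWeightLimit L.embed Λ 𝓕 m) {p : L.Extended}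
    (hp : p ∉ Set.range L.limitPoint) : m p = 0 := by
  have h : ∃ l, ¬ (l ∈ p.2.1 ↔ p.1 l ≠ 0) := by
    by_contra! h
    exact hp (L.mem_range_limitPoint h)
  obtain ⟨l, hl⟩ := h
  have hs : IsClopen {a : ℕ∞ | a ≠ 0 ↔ p.1 l ≠ 0} := by
    have h0 := isClopen_singleton_natCast 0
    by_cases hpl : p.1 l = 0
    · convert h0 using 1; ext a; simp [hpl]
    · convert h0.compl using 1; ext a; simp [hpl]
  refine H.eq_zero_of_mem_isClopen ((L.isClopen_label p.2).inter (L.isClopen_coord l hs))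
    (p := p) ⟨rfl, Iff.rfl⟩ (Eventually.of_forall fun k => ?_)
  have hempty : L.embed ⁻¹' ({p' | p'.2 = p.2} ∩ {p' | p'.1 l ∈ {a : ℕ∞ | a ≠ 0 ↔ p.1 l ≠ 0}})
      = ∅ := by
    ext y
    simp only [Set.mem_preimage, Set.mem_inter_iff, Set.mem_empty_iff_false, iff_false]
    rintro ⟨h1, h2⟩
    refine hl (Iff.trans ?_ h2)
    rw [← show (L.embed y).2 = p.2 from h1]
    simp [embed, label, face]
  rw [hempty, Set.indicator_empty]
  exact map_zero _

/-- Superinvariance on the stratum of `B`: apply the asymptotically invariant functionals to the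
one-step comparison of cylinders, take the limit in `k`, then let `M → ∞`. -/
theorem tsum_induced_le (H : IsWeightLimit L.embed Λ 𝓕 m)
    (hpos : ∀ k φ ψ, φ ≤ ψ → Λ k φ ≤ Λ k ψ)
    (hinv : ∀ φ : L.State → ℝ, 0 ≤ φ → φ ≤ 1 → Tendsto (fun k => Λ k (L.step φ - φ)) 𝓕 (𝓝 0))
    (B : Finset (Fin d)) (q : L.InducedState B) :
    ∑' q', ENNReal.ofReal (m (L.limitPoint ⟨B, q'⟩)) * L.induced B q' q
      ≤ ENNReal.ofReal (m (L.limitPoint ⟨B, q⟩)) := by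
  have key : ∀ (F : Finset (L.InducedState B)) (M : ℕ), 1 ≤ M →
      ∑ q' ∈ F, (L.induced B q' q).toReal * m (L.limitPoint ⟨B, q'⟩)
        ≤ ∑' p, m p * (L.cylinder B M q).indicator 1 p := by
    intro F M hM
    have hl : Tendsto (fun k => ∑ q' ∈ F, (L.induced B q' q).toReal *
        Λ k ((L.stateCylinder B (M + 1) q').indicator 1)) 𝓕
        (𝓝 (∑ q' ∈ F, (L.induced B q' q).toReal *
          ∑' p, m p * (L.cylinder B (M + 1) q').indicator 1 p)) :=
      tendsto_finsetSum _ fun q' _ => Tendsto.const_mul _ <| by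
        have := H.tendsto_indicator (L.isClopen_cylinder B (M + 1) q')
        rwa [preimage_cylinder] at this
    have hr := H.tendsto_indicator (L.isClopen_cylinder B M q)
    rw [preimage_cylinder] at hr
    have h0 := hinv ((L.stateCylinder B M q).indicator 1)
      (fun y => Set.indicator_nonneg (fun _ _ => zero_le_one) _)
      (fun y => Set.indicator_le_self' (by simp) y)
    have hr' := h0.add hr
    rw [zero_add] at hr'
    refine le_trans (Finset.sum_le_sum fun q' _ => mul_le_mul_of_nonneg_left
      (H.le_tsum_indicator (L.limitPoint_mem_cylinder B (M + 1) q')) ENNReal.toReal_nonneg)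
      (le_of_tendsto_of_tendsto' hl hr' fun k => ?_)
    rw [← map_add, sub_add_cancel]
    have hsum : ∑ q' ∈ F, (L.induced B q' q).toReal *
        Λ k ((L.stateCylinder B (M + 1) q').indicator 1)
        = Λ k (∑ q' ∈ F, (L.induced B q' q).toReal •
          (L.stateCylinder B (M + 1) q').indicator 1) := by
      rw [map_sum]
      exact Finset.sum_congr rfl fun q' _ => by rw [map_smul, smul_eq_mul]
    rw [hsum]
    refine hpos k _ _ fun y => ?_
    rw [Finset.sum_apply]
    exact L.sum_induced_mul_le_step B hM F q y
  -- The cylinders shrink to the limit point, and `m` dominates.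
  have hlim : Tendsto (fun M : ℕ => ∑' p, m p * (L.cylinder B M q).indicator 1 p) atTop
      (𝓝 (∑' p, m p * ({L.limitPoint ⟨B, q⟩} : Set L.Extended).indicator 1 p)) := by
    refine tendsto_tsum_of_dominated_convergence (bound := m) H.summable (fun p => ?_)
      (Eventually.of_forall fun M p => ?_)
    · refine Tendsto.const_mul _ ?_
      by_cases hp : p = L.limitPoint ⟨B, q⟩
      · subst hp
        refine tendsto_const_nhds.congr fun M => ?_
        rw [Set.indicator_of_mem (L.limitPoint_mem_cylinder B M q),
          Set.indicator_of_mem (Set.mem_singleton _)]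
      · obtain ⟨M₀, hM₀⟩ : ∃ M, p ∉ L.cylinder B M q := by
          by_contra! h
          exact hp (L.eq_limitPoint_of_forall_mem h)
        refine tendsto_const_nhds.congr' ((eventually_ge_atTop M₀).mono fun M hM => ?_)
        rw [Set.indicator_of_notMem (s := {L.limitPoint ⟨B, q⟩}) hp]
        exact (Set.indicator_of_notMem (fun h => hM₀ ⟨h.1, fun l hl =>
          le_trans (by exact_mod_cast hM) (h.2.1 l hl), h.2.2⟩) _).symm
    · have h01 : (L.cylinder B M q).indicator (1 : L.Extended → ℝ) p ≤ 1 :=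
        Set.indicator_le_self' (by simp) p
      have h00 : 0 ≤ (L.cylinder B M q).indicator (1 : L.Extended → ℝ) p :=
        Set.indicator_nonneg (fun _ _ => zero_le_one) _
      rw [Real.norm_of_nonneg (mul_nonneg (H.nonneg p) h00)]
      exact mul_le_of_le_one_right (H.nonneg p) h01
  have hval : ∑' p, m p * ({L.limitPoint ⟨B, q⟩} : Set L.Extended).indicator 1 p
      = m (L.limitPoint ⟨B, q⟩) := by
    rw [tsum_eq_single (L.limitPoint ⟨B, q⟩) fun p hp => by
      rw [Set.indicator_of_notMem (s := {L.limitPoint ⟨B, q⟩}) hp, mul_zero]]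
    simp
  rw [hval] at hlim
  rw [ENNReal.tsum_eq_iSup_sum]
  refine iSup_le fun F => ?_
  rw [← Finset.sum_congr rfl fun q' _ => show ENNReal.ofReal
      ((L.induced B q' q).toReal * m (L.limitPoint ⟨B, q'⟩))
      = ENNReal.ofReal (m (L.limitPoint ⟨B, q'⟩)) * L.induced B q' q by
    rw [ENNReal.ofReal_mul ENNReal.toReal_nonneg,
      ENNReal.ofReal_toReal (PMF.apply_ne_top _ _), mul_comm],
    ← ENNReal.ofReal_sum_of_nonneg fun q' _ => mul_nonneg ENNReal.toReal_nonneg (H.nonneg _)]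
  refine ENNReal.ofReal_le_ofReal (ge_of_tendsto hlim ?_)
  exact (eventually_ge_atTop 1).mono fun M hM => key F M hM

end MMRRW

/-! ### Continuous extension of the drift and its limiting mean. -/

namespace MMRRW

open Filter Topology

variable {d : ℕ} {L : MMRRW d}

theorem continuous_toNat_min_two : Continuous fun a : ℕ∞ => (min a 2).toNat := by
  refine continuous_iff_continuousAt.2 fun a => ?_
  by_cases ha : a = ⊤
  · subst ha
    refine continuousAt_const.congr (f := fun _ => 2) ?_
    have h2 : Set.Ici ((2 : ℕ) : ℕ∞) ∈ 𝓝 (⊤ : ℕ∞) :=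
      (isClopen_Ici_natCast 2).isOpen.mem_nhds (Set.mem_Ici.2 le_top)
    filter_upwards [h2] with b hb
    rw [min_eq_right (by exact_mod_cast hb)]
    rfl
  · rw [ContinuousAt, ENat.nhds_eq_pure ha]
    exact tendsto_pure_nhds _ _

theorem toNat_min_two (n : ℕ) : (min (n : ℕ∞) 2).toNat = min n 2 := by
  rcases le_total n 2 with h | h
  · rw [min_eq_left h, min_eq_left (by exact_mod_cast h), ENat.toNat_natCast]
  · rw [min_eq_right h, min_eq_right (by exact_mod_cast h)]
    rfl

theorem continuous_heightDrift (L : MMRRW d) (w : Fin d → ℝ) :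
    Continuous fun p : L.Extended =>
      L.heightDrift w (fun l => (min (p.1 l) 2).toNat) p.2 := by
  have h1 : Continuous fun p : L.Extended => (fun l => (min (p.1 l) 2).toNat : Fin d → ℕ) :=
    continuous_pi fun l => continuous_toNat_min_two.comp ((continuous_apply l).comp continuous_fst)
  have h2 : Continuous (Function.uncurry (L.heightDrift w)) := continuous_of_discreteTopology
  exact h2.comp₂ h1 continuous_snd

/-- The continuous extension of the drift of `⟨x, w⟩` to the compactified state space. -/
noncomputable def extendedDrift (L : MMRRW d) (w : Fin d → ℝ) : C(L.Extended, ℝ) where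
  toFun p := L.heightDrift w (fun l => (min (p.1 l) 2).toNat) p.2
  continuous_toFun := L.continuous_heightDrift w

theorem extendedDrift_apply (w : Fin d → ℝ) (p : L.Extended) :
    L.extendedDrift w p = L.heightDrift w (fun l => (min (p.1 l) 2).toNat) p.2 := rfl

theorem extendedDrift_embed (w : Fin d → ℝ) (y : L.State) :
    L.extendedDrift w (L.embed y) = L.step (L.height w) y - L.height w y := by
  rw [← heightDrift_label, extendedDrift_apply]
  refine L.heightDrift_congr w (fun l => ?_) _
  simp only [embed, toNat_min_two]
  omega

theorem extendedDrift_limitPoint (w : Fin d → ℝ) (q : Σ B, L.InducedState B) :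
    L.extendedDrift w (L.limitPoint q) = ∑ l, L.drift (L.lift q.1 q.2) l * w l := by
  rw [sum_drift_mul, ← heightDrift_label, extendedDrift_apply]
  refine L.heightDrift_congr w (fun l => ?_) _
  by_cases hl : l ∈ q.1
  · simp only [limitPoint, lift, glue_mem _ _ hl]
    rfl
  · simp only [limitPoint, lift, glue_notMem _ _ hl, toNat_min_two]
    omega

theorem summable_drift_mul (B : Finset (Fin d)) (l : Fin d) {g : L.InducedState B → ℝ}
    (h0 : ∀ q, 0 ≤ g q) (hg : Summable g) : Summable fun q => L.drift (L.lift B q) l * g q :=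
  Summable.of_norm_bounded hg fun q => by
    rw [Real.norm_eq_abs, abs_mul, abs_of_nonneg (h0 q)]
    exact mul_le_of_le_one_left (h0 q) (L.abs_drift_le _ _)

variable {Λ : ℕ → (L.State → ℝ) →ₗ[ℝ] ℝ} {𝓕 : Filter ℕ} [𝓕.NeBot] {m : L.Extended → ℝ}

/-- The mean drift under a limit of occupation functionals is the combination of the drifts
`⟨a(B), w⟩` weighted by the masses at the points whose infinite coordinates are those in `B`. -/
theorem tsum_limitPoint_mul_extendedDrift (H : IsWeightLimit L.embed Λ 𝓕 m)
    (hpos : ∀ k φ ψ, φ ≤ ψ → Λ k φ ≤ Λ k ψ)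
    (hinv : ∀ φ : L.State → ℝ, 0 ≤ φ → φ ≤ 1 → Tendsto (fun k => Λ k (L.step φ - φ)) 𝓕 (𝓝 0))
    (w : Fin d → ℝ) {B : Finset (Fin d)} (hB : MarkovChain.IsIrreducible (L.induced B))
    (hne : ∑' q : L.InducedState B, m (L.limitPoint ⟨B, q⟩) ≠ 0) :
    MarkovChain.IsPositiveRecurrent (L.induced B) ∧
      ∑' q : L.InducedState B, m (L.limitPoint ⟨B, q⟩) * L.extendedDrift w (L.limitPoint ⟨B, q⟩)
        = (∑' q : L.InducedState B, m (L.limitPoint ⟨B, q⟩)) *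
          ∑ l, L.meanIncrement B l * w l := by
  have hsum : Summable fun q : L.InducedState B => m (L.limitPoint ⟨B, q⟩) :=
    H.summable.comp_injective (L.limitPoint_injective.comp sigma_mk_injective)
  have hof := ENNReal.ofReal_tsum_of_nonneg (fun q : L.InducedState B => H.nonneg _) hsum
  have hM0 : 0 ≤ ∑' q : L.InducedState B, m (L.limitPoint ⟨B, q⟩) := tsum_nonneg fun q => H.nonneg _
  obtain ⟨hrec, hst⟩ := hB.of_superinvariant
    (m := fun q : L.InducedState B => ENNReal.ofReal (m (L.limitPoint ⟨B, q⟩)))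
    (by rw [← hof]; simpa using lt_of_le_of_ne hM0 hne.symm)
    (by rw [← hof]; exact ENNReal.ofReal_ne_top)
    (tsum_induced_le H hpos hinv B)
  set M := ∑' q : L.InducedState B, m (L.limitPoint ⟨B, q⟩) with hM
  have hst' : ∀ q : L.InducedState B, m (L.limitPoint ⟨B, q⟩)
      = M * (MarkovChain.stationaryDist (L.induced B) q).toReal := fun q => by
    have := congrArg ENNReal.toReal (hst q)
    rwa [← hof, ENNReal.toReal_mul, ENNReal.toReal_ofReal (H.nonneg _),
      ENNReal.toReal_ofReal hM0] at this
  have hsd : Summable fun q : L.InducedState B =>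
      (MarkovChain.stationaryDist (L.induced B) q).toReal := by
    refine (summable_mul_left_iff hne).1 (hsum.congr hst')
  refine ⟨hrec, ?_⟩
  have hterm : ∀ q : L.InducedState B,
      m (L.limitPoint ⟨B, q⟩) * L.extendedDrift w (L.limitPoint ⟨B, q⟩)
        = M * ∑ l, L.drift (L.lift B q) l *
          (MarkovChain.stationaryDist (L.induced B) q).toReal * w l := fun q => by
    rw [hst', extendedDrift_limitPoint, mul_assoc, Finset.mul_sum]
    congr 1
    exact Finset.sum_congr rfl fun l _ => by ring
  have hs : ∀ l, Summable fun q : L.InducedState B => L.drift (L.lift B q) l *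
      (MarkovChain.stationaryDist (L.induced B) q).toReal := fun l =>
    summable_drift_mul B l (fun _ => ENNReal.toReal_nonneg) hsd
  rw [tsum_congr hterm, tsum_mul_left, Summable.tsum_finsetSum fun l _ => (hs l).mul_right _]
  congr 1
  exact Finset.sum_congr rfl fun l _ => by rw [tsum_mul_right, meanIncrement]

/-- Stratification by the set of infinite coordinates; `m` vanishes off the limit points. -/
theorem tsum_eq_sum_limitPoint (H : IsWeightLimit L.embed Λ 𝓕 m) {g : L.Extended → ℝ}
    (hg : Summable fun p => m p * g p) : ∑' p, m p * g p
      = ∑ B, ∑' q : L.InducedState B, m (L.limitPoint ⟨B, q⟩) * g (L.limitPoint ⟨B, q⟩) := by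
  rw [← L.limitPoint_injective.tsum_eq (f := fun p => m p * g p) fun p hp => by
    by_contra h
    exact hp (by simp [eq_zero_of_notMem_range H h])]
  have hs := hg.comp_injective L.limitPoint_injective
  exact (Summable.tsum_sigma' (fun B => hs.comp_injective sigma_mk_injective) hs).trans
    (tsum_fintype _)

/-- The mean drift under a limit of occupation functionals is positive, if in the limit some
coordinate in `A` is infinite. -/
theorem tsum_extendedDrift_pos (H : IsWeightLimit L.embed Λ 𝓕 m)
    (hpos : ∀ k φ ψ, φ ≤ ψ → Λ k φ ≤ Λ k ψ) (hone : ∀ k, Λ k 1 = 1)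
    (hinv : ∀ φ : L.State → ℝ, 0 ≤ φ → φ ≤ 1 → Tendsto (fun k => Λ k (L.step φ - φ)) 𝓕 (𝓝 0))
    (hind : ∀ B : Finset (Fin d), B.Nonempty → MarkovChain.IsIrreducible (L.induced B))
    {A : Finset (Fin d)} {w : Fin d → ℝ} (hw : w ∈ L.escapeDirections A)
    (hA : ∀ p, (∀ l ∈ A, p.1 l ≠ ⊤) → m p = 0) : 0 < ∑' p, m p * L.extendedDrift w p := by
  have hbound : Summable fun p => m p * L.extendedDrift w p := by
    refine Summable.of_norm_bounded (H.summable.mul_right ‖L.extendedDrift w‖) fun p => ?_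
    rw [norm_mul, Real.norm_of_nonneg (H.nonneg p)]
    exact mul_le_mul_of_nonneg_left ((L.extendedDrift w).norm_coe_le_norm p) (H.nonneg p)
  have htot : ∑ B, ∑' q : L.InducedState B, m (L.limitPoint ⟨B, q⟩) = 1 := by
    have h := tsum_eq_sum_limitPoint H (g := fun _ => 1) (by simpa using H.summable)
    simp only [mul_one] at h
    rw [← h, H.tsum_eq_one hone]
  have hterm : ∀ B, ∑' q : L.InducedState B, m (L.limitPoint ⟨B, q⟩) ≠ 0 →
      0 < ∑' q : L.InducedState B,
        m (L.limitPoint ⟨B, q⟩) * L.extendedDrift w (L.limitPoint ⟨B, q⟩) := by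
    intro B hB
    -- A charged stratum has an infinite coordinate in `A`. In particular `B` is nonempty, so its
    -- induced chain is irreducible.
    have hBA : (B ∩ A).Nonempty := by
      by_contra h
      rw [Finset.not_nonempty_iff_eq_empty, ← Finset.disjoint_iff_inter_eq_empty] at h
      refine hB ?_
      rw [tsum_congr fun q => hA (L.limitPoint ⟨B, q⟩) fun l hl htop =>
        Finset.disjoint_left.1 h ((L.limitPoint_fst_eq_top ⟨B, q⟩ l).1 htop) hl, tsum_zero]
    obtain ⟨hrec, heq⟩ := tsum_limitPoint_mul_extendedDrift H hpos hinv w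
      (hind B (hBA.mono Finset.inter_subset_left)) hB
    rw [heq]
    exact mul_pos (lt_of_le_of_ne (tsum_nonneg fun q => H.nonneg _) hB.symm) (hw.2.2 B hBA hrec)
  rw [tsum_eq_sum_limitPoint H hbound]
  obtain ⟨B, -, hB⟩ := Finset.exists_ne_zero_of_sum_ne_zero (htot.trans_ne one_ne_zero)
  refine Finset.sum_pos' (fun B' _ => ?_) ⟨B, Finset.mem_univ B, hterm B hB⟩
  by_cases hB' : ∑' q : L.InducedState B', m (L.limitPoint ⟨B', q⟩) = 0
  · have hsum : Summable fun q : L.InducedState B' => m (L.limitPoint ⟨B', q⟩) :=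
      H.summable.comp_injective (L.limitPoint_injective.comp sigma_mk_injective)
    have hz := (hasSum_zero_iff_of_nonneg fun q => H.nonneg _).1 (hB' ▸ hsum.hasSum)
    refine (tsum_congr fun q => ?_).trans tsum_zero |>.ge
    rw [show m (L.limitPoint ⟨B', q⟩) = 0 from congrFun hz q, zero_mul]
  · exact (hterm B' hB').le

/-! ### Occupation functionals -/

/-- The mean over the times `0, …, k` of the function of the walk started at `y`. -/
noncomputable def occupation (L : MMRRW d) (y : L.State) (k : ℕ) : (L.State → ℝ) →ₗ[ℝ] ℝ :=
  ((k : ℝ) + 1)⁻¹ • ∑ n ∈ Finset.range (k + 1),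
    (LinearMap.proj y : (L.State → ℝ) →ₗ[ℝ] ℝ) ∘ₗ (L.step ^ n)

theorem occupation_apply (y : L.State) (k : ℕ) (φ : L.State → ℝ) :
    L.occupation y k φ = ((k : ℝ) + 1)⁻¹ * ∑ n ∈ Finset.range (k + 1), (L.step ^ n) φ y := by
  simp [occupation]

theorem occupation_sub (y : L.State) (k : ℕ) (φ : L.State → ℝ) :
    L.occupation y k (L.step φ - φ) = ((k : ℝ) + 1)⁻¹ * ((L.step ^ (k + 1)) φ y - φ y) := by
  rw [occupation_apply, ← Finset.sum_apply, sum_pow_map_sub]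
  rfl

theorem step_pow_mono (L : MMRRW d) (n : ℕ) {φ ψ : L.State → ℝ} (h : φ ≤ ψ) :
    (L.step ^ n) φ ≤ (L.step ^ n) ψ :=
  ((L.isLocalMono_step 0).pow n).mono h

theorem occupation_mono (y : L.State) (k : ℕ) {φ ψ : L.State → ℝ} (h : φ ≤ ψ) :
    L.occupation y k φ ≤ L.occupation y k ψ := by
  rw [occupation_apply, occupation_apply]
  exact mul_le_mul_of_nonneg_left (Finset.sum_le_sum fun n _ => L.step_pow_mono n h y)
    (by positivity)

theorem occupation_one (y : L.State) (k : ℕ) : L.occupation y k 1 = 1 := by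
  rw [occupation_apply]
  simp only [pow_one_of L.step_one, Pi.one_apply, Finset.sum_const, Finset.card_range,
    nsmul_eq_mul, mul_one]
  push_cast
  exact inv_mul_cancel₀ (by positivity)

/-- The telescoped difference is at most `1 / (k + 1)` whatever the starting point, which may thus
vary with `k`. -/
theorem tendsto_occupation_sub (y : ℕ → L.State) {φ : L.State → ℝ} (h0 : 0 ≤ φ) (h1 : φ ≤ 1) :
    Tendsto (fun k => L.occupation (y k) k (L.step φ - φ)) atTop (𝓝 0) := by
  refine squeeze_zero_norm (fun k => ?_) tendsto_one_div_add_atTop_nhds_zero_nat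
  rw [occupation_sub, norm_mul, norm_inv, Real.norm_of_nonneg (by positivity), one_div]
  refine mul_le_of_le_one_right (by positivity) ?_
  have h2 := L.step_pow_mono (k + 1) h0 (y k)
  have h3 := L.step_pow_mono (k + 1) h1 (y k)
  rw [map_zero] at h2
  rw [pow_one_of L.step_one] at h3
  have h4 := h0 (y k)
  have h5 := h1 (y k)
  simp only [Pi.zero_apply, Pi.one_apply] at h2 h3 h4 h5
  exact abs_le.2 ⟨by linarith, by linarith⟩

/-! ### Positive drift over several steps at large height. -/

theorem step_pow_eq_zero (w : Fin d → ℝ) {φ : L.State → ℝ} {r : ℝ}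
    (h : ∀ y, r ≤ L.height w y → φ y = 0) {n : ℕ} {y : L.State}
    (hy : r + n * ∑ l, |w l| ≤ L.height w y) : (L.step ^ n) φ y = 0 := by
  have hz : ∀ y', |L.height w y' - L.height w y| ≤ n * ∑ l, |w l| → φ y' = 0 := fun y' hy' =>
    h y' (by linarith [(abs_le.1 hy').1])
  have hT := (L.isLocalMono_step w).pow n
  have h1 := hT y φ 0 fun y' hy' => (hz y' hy').le
  have h2 := hT y 0 φ fun y' hy' => (hz y' hy').ge
  rw [map_zero] at h1 h2
  exact le_antisymm h1 h2

/-- Where `⟨x, w⟩` is large, its drift over a fixed number of steps is at least `1`. -/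
theorem exists_drift_ge_one
    (hind : ∀ B : Finset (Fin d), B.Nonempty → MarkovChain.IsIrreducible (L.induced B))
    {A : Finset (Fin d)} {w : Fin d → ℝ} (hw : w ∈ L.escapeDirections A) :
    ∃ t : ℕ, 0 < t ∧ ∃ K : ℝ, ∀ y, K ≤ L.height w y →
      1 ≤ (L.step ^ t) (L.height w) y - L.height w y := by
  by_contra! hcon
  set c := ∑ l, |w l| with hc
  have hc0 : 0 ≤ c := Finset.sum_nonneg fun l _ => abs_nonneg _
  -- At most `k` steps cost at most `(k + 1) * c` of height, so the height stays at least `(k + 1) *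
  -- c + 1` and eventually exceeds any fixed `M * c`.
  choose y hyK hy1 using fun k : ℕ => hcon (k + 1) k.succ_pos (2 * (k + 1) * c + 1)
  obtain ⟨m, H⟩ := exists_limit_weights L.embed (fun k => L.occupation (y k) k)
    (fun k φ ψ h => occupation_mono (y k) k h) (fun k => occupation_one (y k) k) (hyperfilter ℕ)
  have hle : ((hyperfilter ℕ : Ultrafilter ℕ) : Filter ℕ) ≤ atTop :=
    Nat.hyperfilter_le_atTop
  have hA : ∀ p, (∀ l ∈ A, p.1 l ≠ ⊤) → m p = 0 := by
    intro p hp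
    set x : Fin d → ℕ := fun l => (p.1 l).toNat with hx
    have hU : IsClopen (⋂ l ∈ A, {p : L.Extended | p.1 l ∈ ({(x l : ℕ∞)} : Set ℕ∞)}) :=
      isClopen_biInter_finset fun l _ => L.isClopen_coord l (isClopen_singleton_natCast _)
    have hpU : p ∈ ⋂ l ∈ A, {p : L.Extended | p.1 l ∈ ({(x l : ℕ∞)} : Set ℕ∞)} := by
      simp only [Set.mem_iInter]
      exact fun l hl => (ENat.natCast_toNat (hp l hl)).symm
    refine H.eq_zero_of_mem_isClopen hU hpU (Eventually.filter_mono hle ?_)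
    set M : ℕ := ∑ l, x l with hM
    filter_upwards [eventually_ge_atTop M] with k hk
    rw [occupation_apply, Finset.sum_eq_zero, mul_zero]
    intro n hn
    refine step_pow_eq_zero w (r := M * c + 1) (fun y' hy' => ?_) ?_
    · refine Set.indicator_of_notMem (fun hmem => ?_) _
      simp only [Set.mem_preimage, Set.mem_iInter] at hmem
      have hval : ∀ l ∈ A, y'.1 l = x l := fun l hl => by
        have h : ((y'.1 l : ℕ) : ℕ∞) = x l := hmem l hl
        exact_mod_cast h
      -- Coordinates in `A` are fixed and those outside contribute nonpositively, so the height is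
      -- bounded although the latter coordinates are arbitrary.
      have : L.height w y' ≤ M * c := by
        rw [height, hc, Finset.mul_sum]
        refine Finset.sum_le_sum fun l _ => ?_
        by_cases hl : l ∈ A
        · rw [hval l hl]
          have hxl : x l ≤ M := Finset.single_le_sum (fun _ _ => Nat.zero_le _) (Finset.mem_univ l)
          have hxl' : (x l : ℝ) ≤ M := by exact_mod_cast hxl
          exact mul_le_mul hxl' (le_abs_self _) (hw.1 l hl).le (Nat.cast_nonneg _)
        · exact (mul_nonpos_of_nonneg_of_nonpos (Nat.cast_nonneg _) (hw.2.1 l hl).le).trans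
            (by positivity)
      linarith
    · have hnk : (n : ℝ) ≤ k + 1 := by exact_mod_cast (Finset.mem_range.1 hn).le
      have hMk : (M : ℝ) ≤ k := by exact_mod_cast hk
      have := hyK k
      nlinarith
  have hpos := tsum_extendedDrift_pos H (fun k φ ψ h => occupation_mono (y k) k h)
    (fun k => occupation_one (y k) k)
    (fun φ h0 h1 => (tendsto_occupation_sub y h0 h1).mono_left hle) hind hw hA
  refine absurd hpos (not_lt.2 ?_)
  -- The average one-step drift is the gain over `k + 1` steps divided by `k + 1`, hence below `1 /
  -- (k + 1)`.
  refine le_of_tendsto_of_tendsto' (H.tendsto (L.extendedDrift w))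
    (tendsto_one_div_add_atTop_nhds_zero_nat.mono_left hle) fun k => ?_
  have hcomp : L.extendedDrift w ∘ L.embed = L.step (L.height w) - L.height w :=
    funext fun y' => extendedDrift_embed w y'
  rw [hcomp, occupation_sub, one_div]
  exact mul_le_of_le_one_right (by positivity) (hy1 k).le

theorem exists_height_gt {w : Fin d → ℝ} {l : Fin d} (hl : 0 < w l) (K : ℝ) :
    ∃ y : L.State, K < L.height w y := by
  obtain ⟨n, hn⟩ := exists_nat_gt (K / w l)
  refine ⟨⟨Pi.single l n, ⟨0, L.s_pos _⟩⟩, ?_⟩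
  rw [height, Finset.sum_eq_single_of_mem l (Finset.mem_univ l) fun l' _ h => by
    simp [Pi.single_eq_of_ne h]]
  rw [div_lt_iff₀ hl] at hn
  simpa using hn

end MMRRW

/-! ### Transience of the walk. -/

theorem mainTheorem2 {d : ℕ} (L : MMRRW d)
    (hL : MarkovChain.IsIrreducible L.chain)
    (hind : ∀ A : Finset (Fin d), A.Nonempty → MarkovChain.IsIrreducible (L.induced A))
    (hW : ∃ A : Finset (Fin d), A.Nonempty ∧ (L.escapeDirections A).Nonempty) :
    MarkovChain.IsTransient L.chain := by
  obtain ⟨A, ⟨l, hl⟩, w, hw⟩ := hW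
  obtain ⟨t, ht, K, hK⟩ := MMRRW.exists_drift_ge_one hind hw
  obtain ⟨b, hb⟩ := MMRRW.exists_height_gt (L := L) (hw.1 l hl) (max K (t * ∑ l, |w l|))
  let a : L.State := ⟨0, ⟨0, L.s_pos _⟩⟩
  have ha : L.height w a ≤ 0 := by simp [MMRRW.height, a]
  obtain ⟨v, hv0, hv, hab⟩ := (L.isLocalMono_step w).exists_superharmonic L.step_one
    (Finset.sum_nonneg fun _ _ => abs_nonneg _) ht hK ha ((le_max_left _ _).trans_lt hb)
    ((le_max_right _ _).trans_lt hb)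
  refine hL.isTransient_of_superharmonic (v := fun y => ENNReal.ofReal (v y))
    (fun _ => ENNReal.ofReal_ne_top) (fun y => ?_) (a := a) (b := b) ?_
  · rw [L.tsum_chain_mul_ofReal hv0]
    exact ENNReal.ofReal_le_ofReal (hv y)
  · exact fun h => hab ((ENNReal.ofReal_eq_ofReal_iff (hv0 a) (hv0 b)).1 h)
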